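/- Setting. Let $E$ be a separable Banach space, $\hat{\mathcal X}\subseteq E$ an open convex set (for instance $\hat{\mathcal X}=E$, or $\hat{\mathcal X}=(0,\infty)\subset\mathbb R$), and $\mathcal X\subseteq\hat{\mathcal X}$ a Borel set. Let $l:\mathcal X\times\hat{\mathcal X}\to[0,\infty)$ be a measurable loss such that (P1) $\hat x\mapsto l(x,\hat x)$ is convex for every $x\in\mathcal X$; (P2) for every integrable $\mathcal X$-valued random variable $X$, $\min_{\hat x\in\hat{\mathcal X}}\mathbb E[l(X,\hat x)]=\mathbb E[l(X,\mathbb E[X])]$. Let $T\ge 0$, let $(X_t)_{0\le t\le T}$ be a (jointly measurable) $\mathcal X$-valued process and $(Y_t)_{0\le t\le T}$ a process with values in a measurable space, and let $\{P_\theta:\theta\in\Theta\}$ be a nonempty family of probability laws of $(X^T,Y^T)$. A causal filter is a measurable $\hat{\mathcal X}$-valued process $\hat X=(\hat X_t)_{0\le t\le T}$ such that each $\hat X_t$ is a function of $Y^t=(Y_s)_{0\le s\le t}$. Put $$\mathrm{cmle}(\theta,\hat X)=\mathbb E_{P_\theta}\Big[\int_0^T l(X_t,\hat X_t)\,dt\Big],\qquad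 \mathrm{cmle}_{\theta,Q}=\mathbb E_{P_\theta}\Big[\int_0^T l\big(X_t,\mathbb E_Q[X_t\mid Y^t]\big)\,dt\Big],$$ $R(\theta,\hat X)=\mathrm{cmle}(\theta,\hat X)-\mathrm{cmle}_{\theta,P_\theta}$, $R_{\theta,Q}=\mathrm{cmle}_{\theta,Q}-\mathrm{cmle}_{\theta,P_\theta}$, and $$\mathrm{minimax}(\Theta)=\inf_{\hat X}\sup_{\theta\in\Theta}R(\theta,\hat X),$$ the infimum being over all causal filters. Let $\mathcal Q=\mathrm{conv}\{P_\theta:\theta\in\Theta\}$. Assume that these quantities are well defined: $\mathbb E_{P_\theta}\int_0^T\|X_t\|\,dt<\infty$ and $\mathrm{cmle}_{\theta,P_\theta}<\infty$ for all $\theta$, and for each $t\in[0,T]$ the laws of $Y^t$ under the $P_\theta$, $\theta\in\Theta$, are mutually absolutely continuous (so that $\mathrm{cmle}_{\theta,Q}$ does not depend on the version of $\mathbb E_Q[X_t\mid Y^t]$, for all $Q\in\mathcal Q$). Assume moreover that $\mathcal Q$ is compact in some topology for which $Q\mapsto\mathrm{cmle}_{\theta,Q}$ is lower semicontinuous on $\mathcal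 Q$ for every $\theta\in\Theta$ (such a topology always exists if $\Theta$ is finite). Theorem 1. The minimum below is attained, and $$\mathrm{minimax}(\Theta)=\min_{Q\in\mathcal Q}\sup_{\theta\in\Theta}R_{\theta,Q}=\min_{Q\in\mathcal Q}\sup_{\theta\in\Theta}\{\mathrm{cmle}_{\theta,Q}-\mathrm{cmle}_{\theta,P_\theta}\}.$$ Hence the minimax filter may be taken to be Bayesian with respect to a mixture of the $P_\theta$: there is $Q\in\mathcal Q$ for which a Bayesian filter exists (a causal filter with $\hat X_t=\mathbb E_Q[X_t\mid Y^t]$ $Q$-almost surely for almost every $t\in[0,T]$), and every Bayesian filter $\hat X$ for this $Q$ satisfies $\sup_{\theta\in\Theta}R(\theta,\hat X)=\mathrm{minimax}(\Theta)$. -/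

import Mathlib

open MeasureTheory Set
open scoped ENNReal NNReal

noncomputable section

/-- The information carried by the observation path `Y^t = (Y_s, 0 ≤ s ≤ t)`:
the σ-algebra generated by these random variables. -/
abbrev obs {Ω 𝒴 : Type*} [MeasurableSpace 𝒴] (Y : ℝ → Ω → 𝒴) (t : ℝ) : MeasurableSpace Ω :=
  ⨆ s ∈ Icc (0 : ℝ) t, MeasurableSpace.comap (Y s) inferInstance

/-- The loss functions considered, for a signal alphabet `S` and a reconstruction alphabet `K`
inside a Banach space `E`. Only the values `l x u` with `x ∈ S`, `u ∈ K` matter. -/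
structure IsMeanLoss {E : Type*} [NormedAddCommGroup E] [NormedSpace ℝ E] [MeasurableSpace E]
    (S K : Set E) (l : E → E → ℝ≥0) : Prop where
  measurable : Measurable (Function.uncurry l)
  /-- (P1) the loss is convex in the estimate -/
  convex : ∀ x ∈ S, ConvexOn ℝ K (fun u => (l x u : ℝ))
  /-- (P2) for every `S`-valued integrable random variable (of law `ν`), the expected loss
  is minimized over the estimates `u ∈ K` by the mean -/
  mean_min : ∀ ν : Measure E, IsProbabilityMeasure ν → ν Sᶜ = 0 → Integrable id ν →
    ∀ u ∈ K, ∫⁻ x, (l x (∫ y, y ∂ν) : ℝ≥0∞) ∂ν ≤ ∫⁻ x, (l x u : ℝ≥0∞) ∂ν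

/-- Causal filters: `K`-valued measurable processes whose value at time `t ∈ [0, T]` is a
function of `Y^t`. -/
structure IsCausalFilter {E Ω 𝒴 : Type*} [MeasurableSpace E] [MeasurableSpace Ω]
    [MeasurableSpace 𝒴] (T : ℝ) (K : Set E) (Y : ℝ → Ω → 𝒴) (Z : ℝ → Ω → E) : Prop where
  measurable : Measurable (Function.uncurry Z)
  causal : ∀ t ∈ Icc 0 T, Measurable[obs Y t] (Z t)
  mem : ∀ t ∈ Icc 0 T, ∀ ω, Z t ω ∈ K

/-- The causal estimation error `E_P [∫₀ᵀ l(X_t, Z_t) dt]` of the filter `Z` under the law `P`. -/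
def cmle {E Ω : Type*} [MeasurableSpace Ω] (T : ℝ) (l : E → E → ℝ≥0) (X : ℝ → Ω → E)
    (P : Measure Ω) (Z : ℝ → Ω → E) : ℝ≥0∞ :=
  ∫⁻ ω, (∫⁻ t in Icc 0 T, (l (X t ω) (Z t ω) : ℝ≥0∞)) ∂P

/-- The mismatched causal estimation error `E_P [∫₀ᵀ l(X_t, E_Q[X_t | Y^t]) dt]`, under the law
`P`, of the Bayesian filter for the law `Q`. The time integral is the outer one, since the
conditional expectations are chosen for each `t` separately. -/
def cmleBayes {E Ω 𝒴 : Type*} [NormedAddCommGroup E] [NormedSpace ℝ E] [CompleteSpace E]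
    [MeasurableSpace Ω] [MeasurableSpace 𝒴] (T : ℝ) (l : E → E → ℝ≥0) (X : ℝ → Ω → E)
    (Y : ℝ → Ω → 𝒴) (P Q : Measure Ω) : ℝ≥0∞ :=
  ∫⁻ t in Icc 0 T, (∫⁻ ω, (l (X t ω) ((Q[X t | obs Y t]) ω) : ℝ≥0∞) ∂P)

/-- `Z` is a Bayesian filter for the law `Q`: a causal filter such that
`Z_t = E_Q[X_t | Y^t]`, `Q`-almost surely, for almost every `t ∈ [0, T]`. -/
structure IsBayesFilter {E Ω 𝒴 : Type*} [NormedAddCommGroup E] [NormedSpace ℝ E]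
    [CompleteSpace E] [MeasurableSpace E] [MeasurableSpace Ω] [MeasurableSpace 𝒴]
    (T : ℝ) (K : Set E) (X : ℝ → Ω → E) (Y : ℝ → Ω → 𝒴) (Q : Measure Ω)
    (Z : ℝ → Ω → E) : Prop where
  isCausalFilter : IsCausalFilter T K Y Z
  ae_eq : ∀ᵐ t ∂(volume.restrict (Icc 0 T)), Z t =ᵐ[Q] Q[X t | obs Y t]

/-- The regret `R(P, Z)` of the filter `Z` when the active law is `P`. -/
def regret {E Ω 𝒴 : Type*} [NormedAddCommGroup E] [NormedSpace ℝ E] [CompleteSpace E]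
    [MeasurableSpace Ω] [MeasurableSpace 𝒴] (T : ℝ) (l : E → E → ℝ≥0) (X : ℝ → Ω → E)
    (Y : ℝ → Ω → 𝒴) (P : Measure Ω) (Z : ℝ → Ω → E) : EReal :=
  (cmle T l X P Z : EReal) - (cmleBayes T l X Y P P : EReal)

/-- The regret `R_{P, Q}` of the Bayesian filter for `Q` when the active law is `P`. -/
def regretBayes {E Ω 𝒴 : Type*} [NormedAddCommGroup E] [NormedSpace ℝ E] [CompleteSpace E]
    [MeasurableSpace Ω] [MeasurableSpace 𝒴] (T : ℝ) (l : E → E → ℝ≥0) (X : ℝ → Ω → E)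
    (Y : ℝ → Ω → 𝒴) (P Q : Measure Ω) : EReal :=
  (cmleBayes T l X Y P Q : EReal) - (cmleBayes T l X Y P P : EReal)

/-- `minimax(Θ)`: the infimum over all causal filters of the worst-case regret. -/
def minimaxRegret {E Ω 𝒴 Θ : Type*} [NormedAddCommGroup E] [NormedSpace ℝ E] [CompleteSpace E]
    [MeasurableSpace E] [MeasurableSpace Ω] [MeasurableSpace 𝒴] (T : ℝ) (K : Set E)
    (l : E → E → ℝ≥0) (X : ℝ → Ω → E) (Y : ℝ → Ω → 𝒴) (P : Θ → Measure Ω) : EReal :=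
  ⨅ (Z : ℝ → Ω → E) (_ : IsCausalFilter T K Y Z), ⨆ θ, regret T l X Y (P θ) Z

end

/-!
# Minimax regret in causal estimation is attained by a Bayesian filter

Bayesian filters exist (`exists_isBayesFilter`): the conditional expectations `E_Q[X_t | Y^t]`, which
are defined for each `t` separately, have versions that form a jointly measurable adapted process.
Such a process is obtained as one conditional expectation on `ℝ × Ω`, given the σ-algebra
`adaptedSigma` of sets with adapted sections (`hasAdaptedProjection`). For a signal constant in time
this amounts to the left continuity of `t ↦ E[ξ | Y^t]` outside a countable set of times; the general
case follows by a monotone class argument and by density in `L¹`. A mean of points of an open convex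
set stays in it, so the versions can be taken with values in `K`. As the laws are mutually
absolutely continuous on the observations, the regret of a Bayesian filter for a mixture `Q` is
`R_{θ,Q}`, which gives `minimax ≤ sup_θ R_{θ,Q}` for all `Q` (`IsFilteringModel.minimaxRegret_le`).

For the converse, a Bayesian filter for `Q` minimizes the error under `Q` over all causal filters
(`IsBayesFilter.cmle_le`): this is the optimality of the mean, applied to regular conditional
distributions. Let `Q_w` be the mixture of finitely many laws with weights `w`, and `C(w)` its Bayes
risk `∑ i, w i * R_{i,Q_w}`. Then `C` is the minimum over `w'` of the linear functions
`∑ i, w i * R_{i,Q_w'}` of `w`, hence upper semicontinuous, and it is bounded by the minimax regret.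
On the weights that are all at least `κ > 0` it has a maximizer `w`. Comparing `C(w)` with the values
of `C` on a segment from `w` to `v` and letting the point tend to `w`, one gets
`∑ i, v i * R_{i,Q_w} ≤ C(w)` for all `v` (`sum_mul_le_of_isMaxOn`), and so all regrets of `Q_w` are
at most the minimax regret, up to an error that vanishes with `κ`
(`exists_forall_le_of_bayesRisk_le`). The limit requires lower semicontinuity of the regrets along
segments of laws, for which the given topology is of no use. It holds because, by Bayes' rule, the
conditional means of mixtures of two laws move along a segment, where the convex loss is continuous
(`cmleBayes_le_liminf`); the loss need not be known to be continuous on `K`.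

Thus any finitely many of the sets `{Q | R_{θ,Q} ≤ minimax + δ}` have a common point, and the
compactness of the set of mixtures yields a point of all of them
(`IsFilteringModel.exists_regretBayes_le`).
-/

/-! ### Processes adapted to a filtration, as functions measurable for a σ-algebra -/

section AdaptedSigma

open Filter Topology

/-- The σ-algebra on `ℝ × Ω` of the measurable sets all of whose sections at time `t` belong to
`ℱ t`: a process is measurable for it iff it is jointly measurable and adapted to `ℱ`. -/
@[reducible] def adaptedSigma {Ω : Type*} {m : MeasurableSpace Ω} (ℱ : Filtration ℝ m) :
    MeasurableSpace (ℝ × Ω) where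
  MeasurableSet' A := MeasurableSet A ∧ ∀ t, MeasurableSet[ℱ t] (Prod.mk t ⁻¹' A)
  measurableSet_empty := ⟨.empty, fun t => @MeasurableSet.empty _ (ℱ t)⟩
  measurableSet_compl A hA := ⟨hA.1.compl, fun t => (hA.2 t).compl⟩
  measurableSet_iUnion A hA := ⟨.iUnion fun n => (hA n).1, fun t => by
    rw [preimage_iUnion]
    exact @MeasurableSet.iUnion _ _ (ℱ t) _ _ fun n => (hA n).2 t⟩


variable {Ω : Type*} {m : MeasurableSpace Ω} (ℱ : Filtration ℝ m)

theorem adaptedSigma_le : adaptedSigma ℱ ≤ Prod.instMeasurableSpace := fun _ hA => hA.1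

theorem measurable_prodMk_adaptedSigma (t : ℝ) :
    Measurable[ℱ t, adaptedSigma ℱ] (Prod.mk t : Ω → ℝ × Ω) :=
  fun _ hA => hA.2 t

theorem measurable_adaptedSigma {β : Type*} [MeasurableSpace β] {f : ℝ × Ω → β}
    (hf : Measurable f) (hft : ∀ t, Measurable[ℱ t] fun ω => f (t, ω)) :
    Measurable[adaptedSigma ℱ] f :=
  fun _ hB => ⟨hf hB, fun t => hft t hB⟩

variable {ℱ}
variable {E : Type*} [NormedAddCommGroup E] [NormedSpace ℝ E] [CompleteSpace E]
  {τ : Measure ℝ} [IsFiniteMeasure τ] {Q : Measure Ω} [IsFiniteMeasure Q]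

/-- Characterization of the conditional expectation given `adaptedSigma ℱ` through sections. -/
theorem ae_eq_condExp_adaptedSigma {X Z : ℝ × Ω → E} (hX : Integrable X (τ.prod Q))
    (hZm : StronglyMeasurable[adaptedSigma ℱ] Z) (hZ : Integrable Z (τ.prod Q))
    (h : ∀ᵐ t ∂τ, (fun ω => Z (t, ω)) =ᵐ[Q] Q[fun ω => X (t, ω) | ℱ t]) :
    Z =ᵐ[τ.prod Q] (τ.prod Q)[X | adaptedSigma ℱ] := by
  refine ae_eq_condExp_of_forall_setIntegral_eq (adaptedSigma_le ℱ) hX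
    (fun s _ _ => hZ.integrableOn) (fun s hs _ => ?_) hZm.aestronglyMeasurable
  have key : ∀ W : ℝ × Ω → E, Integrable W (τ.prod Q) →
      ∫ p in s, W p ∂(τ.prod Q) = ∫ t, ∫ ω in Prod.mk t ⁻¹' s, W (t, ω) ∂Q ∂τ := by
    intro W hW
    rw [← integral_indicator hs.1, integral_prod _ (hW.indicator hs.1)]
    refine integral_congr_ae (.of_forall fun t => ?_)
    simp only
    rw [← integral_indicator (measurable_prodMk_left hs.1)]
    rfl
  rw [key Z hZ, key X hX]
  refine integral_congr_ae ?_
  filter_upwards [h, hX.prod_right_ae] with t ht hXt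
  rw [integral_congr_ae (ae_restrict_of_ae ht), setIntegral_condExp (ℱ.le t) hXt (hs.2 t)]

/-- The property that the conditional expectation of a process `X` given `adaptedSigma ℱ` is,
at almost every time, the conditional expectation of `X t` given `ℱ t`. -/
def HasAdaptedProjection (ℱ : Filtration ℝ m) (τ : Measure ℝ) (Q : Measure Ω)
    (X : ℝ × Ω → E) : Prop :=
  ∀ᵐ t ∂τ, (fun ω => ((τ.prod Q)[X | adaptedSigma ℱ]) (t, ω)) =ᵐ[Q] Q[fun ω => X (t, ω) | ℱ t]

theorem HasAdaptedProjection.of_eq {X Z : ℝ × Ω → E} (hX : Integrable X (τ.prod Q))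
    (hZm : StronglyMeasurable[adaptedSigma ℱ] Z) (hZ : Integrable Z (τ.prod Q))
    (h : ∀ᵐ t ∂τ, (fun ω => Z (t, ω)) =ᵐ[Q] Q[fun ω => X (t, ω) | ℱ t]) :
    HasAdaptedProjection ℱ τ Q X := by
  filter_upwards [h, Measure.ae_ae_of_ae_prod (ae_eq_condExp_adaptedSigma hX hZm hZ h)]
    with t ht ht'
  exact Filter.EventuallyEq.trans (Filter.EventuallyEq.symm ht') ht

omit [IsFiniteMeasure τ] in
theorem HasAdaptedProjection.congr {X X' : ℝ × Ω → E} (h : X =ᵐ[τ.prod Q] X')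
    (hX : HasAdaptedProjection ℱ τ Q X) : HasAdaptedProjection ℱ τ Q X' := by
  filter_upwards [hX, Measure.ae_ae_of_ae_prod h,
    Measure.ae_ae_of_ae_prod (condExp_congr_ae (m := adaptedSigma ℱ) h)] with t h1 h2 h3
  exact (Filter.EventuallyEq.symm h3).trans (Filter.EventuallyEq.trans h1 (condExp_congr_ae h2))

theorem HasAdaptedProjection.add {X X' : ℝ × Ω → E} (hX : Integrable X (τ.prod Q))
    (hX' : Integrable X' (τ.prod Q)) (h : HasAdaptedProjection ℱ τ Q X)
    (h' : HasAdaptedProjection ℱ τ Q X') : HasAdaptedProjection ℱ τ Q (X + X') := by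
  filter_upwards [h, h', hX.prod_right_ae, hX'.prod_right_ae,
    Measure.ae_ae_of_ae_prod (condExp_add hX hX' (adaptedSigma ℱ))] with t h1 h2 h3 h4 h5
  refine Filter.EventuallyEq.trans h5 ((h1.add h2).trans ?_)
  exact (condExp_add h3 h4 (ℱ t)).symm

theorem HasAdaptedProjection.sub {X X' : ℝ × Ω → E} (hX : Integrable X (τ.prod Q))
    (hX' : Integrable X' (τ.prod Q)) (h : HasAdaptedProjection ℱ τ Q X)
    (h' : HasAdaptedProjection ℱ τ Q X') : HasAdaptedProjection ℱ τ Q (X - X') := by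
  filter_upwards [h, h', hX.prod_right_ae, hX'.prod_right_ae,
    Measure.ae_ae_of_ae_prod (condExp_sub hX hX' (adaptedSigma ℱ))] with t h1 h2 h3 h4 h5
  refine Filter.EventuallyEq.trans h5 ((h1.sub h2).trans ?_)
  exact (condExp_sub h3 h4 (ℱ t)).symm

/-- The property `HasAdaptedProjection` is closed in `L¹`, because both conditional expectations
are contractions of `L¹`. -/
theorem HasAdaptedProjection.of_approx {X : ℝ × Ω → E} (hX : Integrable X (τ.prod Q))
    (h : ∀ ε : ℝ≥0∞, 0 < ε → ∃ X', Integrable X' (τ.prod Q) ∧ HasAdaptedProjection ℱ τ Q X' ∧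
      eLpNorm (X - X') 1 (τ.prod Q) ≤ ε) : HasAdaptedProjection ℱ τ Q X := by
  obtain ⟨u, -, hu0, hulim⟩ := exists_seq_strictAnti_tendsto' (α := ℝ≥0∞) zero_lt_one
  choose X' hX'i hX' hX'e using fun n => h (u n) (hu0 n).1
  let W : ℕ → ℝ × Ω → E := fun n => (τ.prod Q)[X - X' n | adaptedSigma ℱ]
  -- bounds that are measurable in `t`, for the distance of the two conditional expectations at
  -- time `t`, which is not known to be so
  let e : ℕ → ℝ → ℝ≥0∞ := fun n t => ∫⁻ ω, ‖W n (t, ω)‖ₑ ∂Q + ∫⁻ ω, ‖(X - X' n) (t, ω)‖ₑ ∂Q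
  have hWi : ∀ n, Integrable (W n) (τ.prod Q) := fun n => integrable_condExp
  have hDi : ∀ n, Integrable (X - X' n) (τ.prod Q) := fun n => hX.sub (hX'i n)
  have hem : ∀ n, AEMeasurable (e n) τ := fun n =>
    (hWi n).1.enorm.lintegral_prod_right'.add (hDi n).1.enorm.lintegral_prod_right'
  have hei : ∀ n, ∫⁻ t, e n t ∂τ ≤ u n + u n := by
    intro n
    rw [lintegral_add_left' (hWi n).1.enorm.lintegral_prod_right',
      ← lintegral_prod _ (hWi n).1.enorm, ← lintegral_prod _ (hDi n).1.enorm,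
      ← eLpNorm_one_eq_lintegral_enorm, ← eLpNorm_one_eq_lintegral_enorm]
    exact add_le_add ((eLpNorm_condExp_le_eLpNorm _ le_rfl).trans (hX'e n)) (hX'e n)
  have hinf : ∀ᵐ t ∂τ, ⨅ n, e n t = 0 := by
    have h0 : ∫⁻ t, ⨅ n, e n t ∂τ = 0 := by
      refine le_antisymm (ge_of_tendsto' (f := fun n => u n + u n) (x := atTop) ?_ fun n => ?_)
        zero_le
      · simpa using hulim.add hulim
      · exact (lintegral_mono fun t => iInf_le _ n).trans (hei n)
    exact (lintegral_eq_zero_iff' (.iInf hem)).1 h0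
  have hall : ∀ᵐ t ∂τ, ∀ n, ∫⁻ ω, ‖((τ.prod Q)[X | adaptedSigma ℱ]) (t, ω)
      - (Q[fun ω => X (t, ω) | ℱ t]) ω‖ₑ ∂Q ≤ e n t := by
    refine ae_all_iff.2 fun n => ?_
    filter_upwards [hX' n, (hDi n).prod_right_ae, hX.prod_right_ae, (hX'i n).prod_right_ae,
      (hWi n).1.prodMk_left,
      Measure.ae_ae_of_ae_prod (condExp_sub hX (hX'i n) (adaptedSigma ℱ))]
      with t h1 h2 h3 h4 h5 h6
    have hs : Q[fun ω => (X - X' n) (t, ω) | ℱ t] =ᵐ[Q]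
      Q[fun ω => X (t, ω) | ℱ t] - Q[fun ω => X' n (t, ω) | ℱ t] := condExp_sub h3 h4 (ℱ t)
    calc ∫⁻ ω, ‖((τ.prod Q)[X | adaptedSigma ℱ]) (t, ω)
          - (Q[fun ω => X (t, ω) | ℱ t]) ω‖ₑ ∂Q
        ≤ ∫⁻ ω, (‖W n (t, ω)‖ₑ + ‖(Q[fun ω => (X - X' n) (t, ω) | ℱ t]) ω‖ₑ) ∂Q := by
          refine lintegral_mono_ae ?_
          filter_upwards [h1, h6, hs] with ω k1 k2 k3
          simp only [W]
          rw [k2, k3, Pi.sub_apply, Pi.sub_apply, k1]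
          refine le_trans (le_of_eq ?_) (enorm_sub_le)
          congr 1
          abel
      _ = ∫⁻ ω, ‖W n (t, ω)‖ₑ ∂Q + ∫⁻ ω, ‖(Q[fun ω => (X - X' n) (t, ω) | ℱ t]) ω‖ₑ ∂Q :=
          lintegral_add_left' h5.enorm _
      _ ≤ e n t := by
          refine add_le_add le_rfl ?_
          have := eLpNorm_condExp_le_eLpNorm (μ := Q) (m := ℱ t)
            (fun ω => (X - X' n) (t, ω)) (p := 1) le_rfl
          rwa [eLpNorm_one_eq_lintegral_enorm, eLpNorm_one_eq_lintegral_enorm] at this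
  filter_upwards [hall, hinf, integrable_condExp.1.prodMk_left (f := (τ.prod Q)[X | adaptedSigma ℱ])]
    with t h1 h2 h3
  have h0 : ∫⁻ ω, ‖((τ.prod Q)[X | adaptedSigma ℱ]) (t, ω)
      - (Q[fun ω => X (t, ω) | ℱ t]) ω‖ₑ ∂Q = 0 :=
    le_antisymm ((le_iInf h1).trans h2.le) zero_le
  filter_upwards [(lintegral_eq_zero_iff' (h3.sub integrable_condExp.1).enorm).1 h0] with ω hω
  simpa [sub_eq_zero] using hω

/-- Pythagoras' identity for the conditional expectations of a bounded variable. -/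
theorem integral_sq_condExp_sub {ξ : Ω → ℝ} (hb : ∀ ω, |ξ ω| ≤ 1)
    {m₁ m₂ : MeasurableSpace Ω} (h₁₂ : m₁ ≤ m₂) (h₂ : m₂ ≤ m) :
    ∫ ω, ((Q[ξ | m₂]) ω - (Q[ξ | m₁]) ω) ^ 2 ∂Q
      = ∫ ω, (Q[ξ | m₂]) ω ^ 2 ∂Q - ∫ ω, (Q[ξ | m₁]) ω ^ 2 ∂Q := by
  have hb' : ∀ m' : MeasurableSpace Ω, ∀ᵐ ω ∂Q, ‖(Q[ξ | m']) ω‖ ≤ (1 : ℝ) := fun m' =>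
    ae_bdd_norm_condExp_of_ae_bdd_norm (R := 1) (.of_forall fun ω => hb ω)
  have hi : ∀ m' m'' : MeasurableSpace Ω, Integrable (Q[ξ | m'] * Q[ξ | m'']) Q := fun m' m'' =>
    Integrable.bdd_mul (c := 1) integrable_condExp integrable_condExp.1 (hb' m')
  have hcross : ∫ ω, (Q[ξ | m₁] * Q[ξ | m₂]) ω ∂Q = ∫ ω, (Q[ξ | m₁] * Q[ξ | m₁]) ω ∂Q := by
    have h1 := condExp_mul_of_stronglyMeasurable_left (μ := Q) (m := m₁)
      (stronglyMeasurable_condExp (f := ξ)) (hi m₁ m₂) integrable_condExp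
    have h2 : Q[Q[ξ | m₂] | m₁] =ᵐ[Q] Q[ξ | m₁] := condExp_condExp_of_le h₁₂ h₂
    rw [← integral_condExp (h₁₂.trans h₂)]
    refine integral_congr_ae (h1.trans ?_)
    filter_upwards [h2] with ω hω
    simp [hω]
  have e1 : ∀ ω, ((Q[ξ | m₂]) ω - (Q[ξ | m₁]) ω) ^ 2 = (Q[ξ | m₂] * Q[ξ | m₂]) ω
      - 2 * (Q[ξ | m₁] * Q[ξ | m₂]) ω + (Q[ξ | m₁] * Q[ξ | m₁]) ω := by
    intro ω; simp only [Pi.mul_apply]; ring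
  have e2 : ∀ m' : MeasurableSpace Ω, ∀ ω, (Q[ξ | m']) ω ^ 2 = (Q[ξ | m'] * Q[ξ | m']) ω := by
    intro m' ω; simp only [Pi.mul_apply]; ring
  simp_rw [e1, e2]
  rw [integral_add (f := fun ω => (Q[ξ | m₂] * Q[ξ | m₂]) ω - 2 * (Q[ξ | m₁] * Q[ξ | m₂]) ω)
      ((hi m₂ m₂).sub ((hi m₁ m₂).const_mul 2)) (hi m₁ m₁),
    integral_sub (hi m₂ m₂) ((hi m₁ m₂).const_mul 2), integral_const_mul, hcross]
  ring

end AdaptedSigma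

/-! ### Jointly measurable adapted versions of conditional expectations -/

section AdaptedProjection

open Filter Topology

variable {Ω : Type*} {m : MeasurableSpace Ω} {ℱ : Filtration ℝ m}
  {τ : Measure ℝ} [IsFiniteMeasure τ] {Q : Measure Ω} [IsFiniteMeasure Q]

/-- The largest multiple of `2⁻ⁿ` below `t`. -/
noncomputable def dyadicFloor (n : ℕ) (t : ℝ) : ℝ := ⌊2 ^ n * t⌋ / 2 ^ n

theorem dyadicFloor_le (n : ℕ) (t : ℝ) : dyadicFloor n t ≤ t := by
  rw [dyadicFloor, div_le_iff₀ (by positivity), mul_comm t]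
  exact Int.floor_le _

theorem monotone_dyadicFloor (t : ℝ) : Monotone fun n => dyadicFloor n t := by
  refine monotone_nat_of_le_succ fun n => ?_
  rw [dyadicFloor, dyadicFloor, div_le_div_iff₀ (by positivity) (by positivity), pow_succ,
    mul_comm ((2 : ℝ) ^ n) 2, ← mul_assoc]
  refine mul_le_mul_of_nonneg_right ?_ (by positivity)
  have h : (⌊2 ^ n * t⌋ * 2 : ℤ) ≤ ⌊2 * 2 ^ n * t⌋ := by
    rw [Int.le_floor]
    push_cast
    linarith [Int.floor_le (2 ^ n * t)]
  exact_mod_cast h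

theorem tendsto_dyadicFloor (t : ℝ) : Tendsto (fun n => dyadicFloor n t) atTop (𝓝 t) := by
  have h : Tendsto (fun n : ℕ => t - (1 / 2 : ℝ) ^ n) atTop (𝓝 t) := by
    simpa using (tendsto_pow_atTop_nhds_zero_of_lt_one (r := (1 / 2 : ℝ)) (by norm_num)
      (by norm_num)).const_sub t
  refine tendsto_of_tendsto_of_tendsto_of_le_of_le h tendsto_const_nhds (fun n => ?_)
    fun n => dyadicFloor_le n t
  simp only [dyadicFloor]
  rw [le_div_iff₀ (by positivity), sub_mul, ← mul_pow]
  norm_num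
  linarith [Int.lt_floor_add_one (2 ^ n * t)]

omit [IsFiniteMeasure τ] in
/-- Off a countable set of times, the conditional expectation given `ℱ t` is the one given the
left limit of `ℱ` at `t`: by Pythagoras, equality holds wherever the monotone function
`t ↦ E[E[ξ | ℱ t]²]` is continuous. -/
theorem ae_condExp_iSup_dyadicFloor [NullSingletonClass τ] {ξ : Ω → ℝ} (hb : ∀ ω, |ξ ω| ≤ 1) :
    ∀ᵐ t ∂τ, Q[ξ | ⨆ n, ℱ (dyadicFloor n t)] =ᵐ[Q] Q[ξ | ℱ t] := by
  let φ : MeasurableSpace Ω → ℝ := fun m' => ∫ ω, (Q[ξ | m']) ω ^ 2 ∂Q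
  have hφ : ∀ m₁ m₂ : MeasurableSpace Ω, m₁ ≤ m₂ → m₂ ≤ m → φ m₁ ≤ φ m₂ := fun m₁ m₂ h h' => by
    have h1 := integral_sq_condExp_sub (Q := Q) hb h h'
    have h2 : 0 ≤ ∫ ω, ((Q[ξ | m₂]) ω - (Q[ξ | m₁]) ω) ^ 2 ∂Q :=
      integral_nonneg fun ω => sq_nonneg _
    simp only [φ]
    linarith
  have hmono : Monotone fun t => φ (ℱ t) := fun s t hst => hφ _ _ (ℱ.mono hst) (ℱ.le t)
  filter_upwards [hmono.countable_not_continuousAt.ae_notMem τ] with t ht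
  rw [not_not] at ht
  have hle : ⨆ n, ℱ (dyadicFloor n t) ≤ ℱ t := iSup_le fun n => ℱ.mono (dyadicFloor_le n t)
  have heq : φ (⨆ n, ℱ (dyadicFloor n t)) = φ (ℱ t) := by
    refine le_antisymm (hφ _ _ hle (ℱ.le t)) ?_
    refine le_of_tendsto' (ht.tendsto.comp (tendsto_dyadicFloor t)) fun n => ?_
    exact hφ _ _ (le_iSup (fun n => ℱ (dyadicFloor n t)) n) (hle.trans (ℱ.le t))
  have h0 : ∫ ω, ((Q[ξ | ℱ t]) ω - (Q[ξ | ⨆ n, ℱ (dyadicFloor n t)]) ω) ^ 2 ∂Q = 0 := by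
    rw [integral_sq_condExp_sub hb hle (ℱ.le t)]
    exact sub_eq_zero.2 heq.symm
  have hb' : ∀ m' : MeasurableSpace Ω, ∀ᵐ ω ∂Q, |(Q[ξ | m']) ω| ≤ (1 : ℝ) := fun m' =>
    ae_bdd_norm_condExp_of_ae_bdd_norm (f := ξ) (R := 1) (.of_forall fun ω => hb ω)
  have hint : Integrable (fun ω => ((Q[ξ | ℱ t]) ω - (Q[ξ | ⨆ n, ℱ (dyadicFloor n t)]) ω) ^ 2)
      Q := by
    refine Integrable.of_bound (C := 4)
      ((integrable_condExp.sub integrable_condExp).1.pow 2) ?_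
    filter_upwards [hb' (ℱ t), hb' (⨆ n, ℱ (dyadicFloor n t))] with ω h1 h2
    rw [Real.norm_eq_abs, abs_of_nonneg (sq_nonneg _)]
    rw [abs_le] at h1 h2
    nlinarith
  rw [integral_eq_zero_iff_of_nonneg (fun ω => sq_nonneg _) hint] at h0
  filter_upwards [h0] with ω hω
  have : (Q[ξ | ℱ t]) ω - (Q[ξ | ⨆ n, ℱ (dyadicFloor n t)]) ω = 0 := by simpa using hω
  linarith

omit [IsFiniteMeasure Q] in
theorem measurable_condExp_dyadicFloor (ξ : Ω → ℝ) (n : ℕ) :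
    Measurable fun p : ℝ × Ω => (Q[ξ | ℱ (dyadicFloor n p.1)]) p.2 := by
  have h : Measurable fun p : ℤ × Ω => (Q[ξ | ℱ (p.1 / 2 ^ n)]) p.2 :=
    measurable_from_prod_countable_right fun k =>
      (stronglyMeasurable_condExp.mono (ℱ.le ((k : ℝ) / 2 ^ n))).measurable
  exact h.comp (((measurable_const.mul measurable_fst).floor).prodMk measurable_snd)

theorem hasAdaptedProjection_indicator_prod [NullSingletonClass τ] {B : Set ℝ} {A : Set Ω}
    (hB : MeasurableSet B) (hA : MeasurableSet A) :
    HasAdaptedProjection ℱ τ Q ((B ×ˢ A).indicator fun _ => (1 : ℝ)) := by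
  let ξ : Ω → ℝ := A.indicator fun _ => 1
  have hξ : Integrable ξ Q := (integrable_const 1).indicator hA
  have hξ0 : ∀ ω, 0 ≤ ξ ω := fun ω => indicator_nonneg (fun _ _ => zero_le_one) ω
  have hξ1 : ∀ ω, ξ ω ≤ 1 := fun ω => indicator_le_self' (fun _ _ => zero_le_one) ω
  have hb : ∀ ω, |ξ ω| ≤ 1 := fun ω => abs_le.2 ⟨by linarith [hξ0 ω], hξ1 ω⟩
  let M : ℕ → ℝ × Ω → ℝ := fun n p => (Q[ξ | ℱ (dyadicFloor n p.1)]) p.2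
  -- the truncation makes `Z` bounded everywhere, hence integrable
  let Z : ℝ × Ω → ℝ := fun p =>
    B.indicator (fun _ => max 0 (min 1 (limsup (fun n => M n p) atTop))) p.1
  have hM : ∀ n, Measurable[adaptedSigma ℱ] (M n) := fun n =>
    measurable_adaptedSigma ℱ (measurable_condExp_dyadicFloor ξ n) fun t =>
      (stronglyMeasurable_condExp.mono (ℱ.mono (dyadicFloor_le n t))).measurable
  have hfst : Measurable[adaptedSigma ℱ] (Prod.fst : ℝ × Ω → ℝ) :=
    measurable_adaptedSigma ℱ measurable_fst fun t => measurable_const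
  have hZ : Measurable[adaptedSigma ℱ] Z := by
    let := adaptedSigma ℱ
    have h : Measurable[adaptedSigma ℱ] fun p : ℝ × Ω =>
      max 0 (min 1 (limsup (fun n => M n p) atTop)) :=
      measurable_const.max (measurable_const.min (Measurable.limsup hM))
    exact Measurable.indicator h (hfst hB)
  have hZb : ∀ p, ‖Z p‖ ≤ 1 := by
    intro p
    by_cases hp : p.1 ∈ B
    · simp only [Z, indicator_of_mem hp, Real.norm_eq_abs]
      rw [abs_of_nonneg (le_max_left _ _)]
      exact max_le zero_le_one (min_le_left _ _)
    · simp [Z, indicator_of_notMem hp]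
  refine HasAdaptedProjection.of_eq ((integrable_const 1).indicator (hB.prod hA))
    hZ.stronglyMeasurable (.of_bound (C := 1)
      (hZ.mono (adaptedSigma_le ℱ) le_rfl).aestronglyMeasurable (.of_forall hZb)) ?_
  filter_upwards [ae_condExp_iSup_dyadicFloor (ℱ := ℱ) (τ := τ) (Q := Q) hb] with t ht
  by_cases htB : t ∈ B
  · have e1 : (fun ω => (B ×ˢ A).indicator (fun _ => (1 : ℝ)) (t, ω)) = ξ := by
      ext ω
      by_cases hω : ω ∈ A <;> simp [ξ, htB, hω]
    rw [e1]
    let 𝒢 : Filtration ℕ m :=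
      ⟨fun n => ℱ (dyadicFloor n t), fun i j hij => ℱ.mono (monotone_dyadicFloor t hij),
        fun n => ℱ.le _⟩
    have hlim := tendsto_ae_condExp (μ := Q) (ℱ := 𝒢) ξ
    have h0 : 0 ≤ᵐ[Q] Q[ξ | ℱ t] := condExp_nonneg (.of_forall hξ0)
    have h1 : Q[ξ | ℱ t] ≤ᵐ[Q] fun _ => 1 := by
      have := condExp_mono (m := ℱ t) hξ (integrable_const (1 : ℝ)) (.of_forall hξ1)
      rwa [condExp_const (ℱ.le t)] at this
    filter_upwards [hlim, ht, h0, h1] with ω k1 k2 k3 k4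
    have k5 : limsup (fun n => M n (t, ω)) atTop = (Q[ξ | ℱ t]) ω := by
      rw [← k2]
      exact k1.limsup_eq
    simp only [Z, indicator_of_mem htB, k5]
    rw [min_eq_right k4, max_eq_right (show (0 : ℝ) ≤ _ from k3)]
  · have e1 : (fun ω => (B ×ˢ A).indicator (fun _ => (1 : ℝ)) (t, ω)) = 0 := by
      ext ω
      simp [htB]
    rw [e1, condExp_zero]
    refine .of_forall fun ω => ?_
    simp [Z, htB]

theorem hasAdaptedProjection_indicator [NullSingletonClass τ] {A : Set (ℝ × Ω)} (hA : MeasurableSet A) :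
    HasAdaptedProjection ℱ τ Q (A.indicator fun _ => (1 : ℝ)) := by
  have hi : ∀ A : Set (ℝ × Ω), MeasurableSet A →
      Integrable (A.indicator fun _ => (1 : ℝ)) (τ.prod Q) :=
    fun A hA => (integrable_const 1).indicator hA
  induction A, hA using MeasurableSpace.induction_on_inter generateFrom_prod.symm
    isPiSystem_prod with
  | empty =>
    have := hasAdaptedProjection_indicator_prod (ℱ := ℱ) (τ := τ) (Q := Q) .empty .empty
    simpa using this
  | basic A hA =>
    obtain ⟨B, hB, C, hC, rfl⟩ := hA
    exact hasAdaptedProjection_indicator_prod hB hC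
  | compl A hA ih =>
    have h1 := hasAdaptedProjection_indicator_prod (ℱ := ℱ) (τ := τ) (Q := Q) .univ .univ
    have h2 := h1.sub (hi _ (MeasurableSet.univ.prod .univ)) (hi A hA) ih
    rwa [univ_prod_univ, ← indicator_sdiff (subset_univ A), ← compl_eq_univ_sdiff] at h2
  | iUnion A hd hA ih =>
    have hU : ∀ n, MeasurableSet (⋃ i < n, A i) := fun n => .iUnion fun i => .iUnion fun _ => hA i
    have hpart : ∀ n, HasAdaptedProjection ℱ τ Q
        ((⋃ i < n, A i).indicator fun _ => (1 : ℝ)) := by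
      intro n
      induction n with
      | zero =>
        have := hasAdaptedProjection_indicator_prod (ℱ := ℱ) (τ := τ) (Q := Q) .empty .empty
        simpa using this
      | succ n ihn =>
        have hdis : Disjoint (⋃ i < n, A i) (A n) := by
          simp only [disjoint_iUnion_left]
          exact fun i hi => hd (ne_of_lt hi)
        rw [biUnion_lt_succ, indicator_union_of_disjoint hdis]
        exact ihn.add (hi _ (hU n)) (hi _ (hA n)) (ih n)
    refine HasAdaptedProjection.of_approx (hi _ (.iUnion hA)) fun ε hε => ?_
    have hlim : Tendsto (fun n => (τ.prod Q) ((⋃ i, A i) \ ⋃ i < n, A i)) atTop (𝓝 0) := by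
      have hanti : Antitone fun n => (⋃ i, A i) \ ⋃ i < n, A i := fun a b hab =>
        sdiff_subset_sdiff_right (biUnion_subset_biUnion_left fun i hi => lt_of_lt_of_le hi hab)
      have h := tendsto_measure_iInter_atTop (μ := τ.prod Q)
        (s := fun n => (⋃ i, A i) \ ⋃ i < n, A i)
        (fun n => ((MeasurableSet.iUnion hA).diff (hU n)).nullMeasurableSet) hanti
        ⟨0, measure_ne_top _ _⟩
      have he : ⋂ n, ((⋃ i, A i) \ ⋃ i < n, A i) = ∅ := by
        refine eq_empty_of_forall_notMem fun p hp => ?_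
        rw [mem_iInter] at hp
        obtain ⟨i, hi⟩ := mem_iUnion.1 (hp 0).1
        exact (hp (i + 1)).2 (mem_biUnion (Nat.lt_succ_self i) hi)
      simpa [he, Function.comp_def] using h
    obtain ⟨n, hn⟩ := (hlim.eventually (gt_mem_nhds hε)).exists
    refine ⟨(⋃ i < n, A i).indicator fun _ => 1, hi _ (hU n), hpart n, ?_⟩
    rw [← indicator_sdiff (iUnion₂_subset fun i _ => subset_iUnion A i),
      eLpNorm_one_eq_lintegral_enorm]
    simp only [enorm_indicator_eq_indicator_enorm]
    rw [lintegral_indicator ((MeasurableSet.iUnion hA).diff (hU n))]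
    simpa using hn.le

variable {E : Type*} [NormedAddCommGroup E] [NormedSpace ℝ E] [CompleteSpace E]

theorem HasAdaptedProjection.smul_const {f : ℝ × Ω → ℝ} (hf : Integrable f (τ.prod Q))
    (h : HasAdaptedProjection ℱ τ Q f) (c : E) :
    HasAdaptedProjection ℱ τ Q fun p => f p • c := by
  let L : ℝ →L[ℝ] E := (ContinuousLinearMap.id ℝ ℝ).smulRight c
  filter_upwards [h, hf.prod_right_ae, Measure.ae_ae_of_ae_prod
    (L.comp_condExp_comm (m := adaptedSigma ℱ) hf)] with t h1 h2 h3
  have h4 := L.comp_condExp_comm (m := ℱ t) h2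
  filter_upwards [h1, h3, h4] with ω k1 k2 k3
  refine k2.symm.trans (Eq.trans ?_ k3)
  simp only [Function.comp_apply, k1]

/-- Every integrable process has a projection: the conditional expectations given the
σ-algebras of a filtration can be chosen so as to form a jointly measurable adapted process. -/
theorem hasAdaptedProjection [NullSingletonClass τ] {X : ℝ × Ω → E} (hX : Integrable X (τ.prod Q)) :
    HasAdaptedProjection ℱ τ Q X := by
  refine Integrable.induction (HasAdaptedProjection ℱ τ Q) (fun c s hs _ => ?_)
    (fun f g _ hf hg h h' => h.add hf hg h') ?_ (fun f g hfg _ h => h.congr hfg) hX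
  · have := (hasAdaptedProjection_indicator (ℱ := ℱ) (τ := τ) (Q := Q) hs).smul_const
      ((integrable_const 1).indicator hs) c
    convert this using 2 with p
    by_cases hp : p ∈ s <;> simp [hp]
  · refine isClosed_of_closure_subset fun f hf => ?_
    refine HasAdaptedProjection.of_approx (L1.integrable_coeFn f) fun ε hε => ?_
    obtain ⟨g, hg, hfg⟩ := EMetric.mem_closure_iff.1 hf ε hε
    rw [Lp.edist_def] at hfg
    exact ⟨g, L1.integrable_coeFn g, hg, hfg.le⟩

end AdaptedProjection

/-! ### Optimality of the conditional mean -/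

section Static

variable {E : Type*} [NormedAddCommGroup E] [NormedSpace ℝ E] [CompleteSpace E]
  [SecondCountableTopology E] [MeasurableSpace E] [BorelSpace E]

omit [SecondCountableTopology E] [BorelSpace E] in
/-- The mean of a probability measure carried by an open convex set lies in that set, by strict
separation of a point from an open convex set. -/
theorem integral_id_mem_of_isOpen {K : Set E} (hKo : IsOpen K) (hKc : Convex ℝ K)
    {ν : Measure E} [IsProbabilityMeasure ν] (hν : ∀ᵐ x ∂ν, x ∈ K)
    (hi : Integrable (fun y : E => y) ν) : ∫ y, y ∂ν ∈ K := by
  by_contra hm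
  obtain ⟨f, hf⟩ := geometric_hahn_banach_open_point hKc hKo hm
  have h1 : f (∫ y, y ∂ν) = ∫ y, f y ∂ν := (f.integral_comp_comm hi).symm
  have h2 : 0 < ∫ y, (f (∫ z, z ∂ν) - f y) ∂ν := by
    have hint : Integrable (fun y => f (∫ z, z ∂ν) - f y) ν :=
      (integrable_const _).sub (f.integrable_comp hi)
    rw [integral_pos_iff_support_of_nonneg_ae ?_ hint]
    · refine lt_of_lt_of_le (b := ν univ) (by simp) (measure_mono_ae ?_)
      filter_upwards [hν] with y hy _
      exact (sub_pos.2 (hf y hy)).ne'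
    · filter_upwards [hν] with y hy
      exact (sub_pos.2 (hf y hy)).le
  rw [integral_sub (integrable_const _) (f.integrable_comp hi), ← h1] at h2
  simp at h2

open ProbabilityTheory in
/-- A regular conditional distribution of `X` given the σ-algebra `F`, with the properties that
Bayes optimality rests on. -/
theorem exists_condKernel {Ω : Type*} {F m : MeasurableSpace Ω} (hF : F ≤ m)
    (P : Measure Ω) [IsProbabilityMeasure P] {X : Ω → E} (hX : Measurable X)
    (hi : Integrable X P) :
    ∃ κ : @Kernel Ω E F _, (∀ ω, IsProbabilityMeasure (κ ω)) ∧
      (∀ h : Ω × E → ℝ≥0∞, Measurable[F.prod inferInstance] h →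
        ∫⁻ ω, h (ω, X ω) ∂P = ∫⁻ ω, ∫⁻ x, h (ω, x) ∂(κ ω) ∂P) ∧
      (∀ A, MeasurableSet A → (∀ᵐ ω ∂P, X ω ∈ A) → ∀ᵐ ω ∂P, ∀ᵐ x ∂(κ ω), x ∈ A) ∧
      (∀ᵐ ω ∂P, Integrable (fun y : E => y) (κ ω)) ∧
      P[X | F] =ᵐ[P] fun ω => ∫ y, y ∂(κ ω) := by
  have hid : @Measurable Ω Ω m F id := measurable_id'' hF
  let κ := @condDistrib Ω Ω E _ _ _ m F X id P _
  have hlint : ∀ h : Ω × E → ℝ≥0∞, Measurable[F.prod inferInstance] h →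
      ∫⁻ ω, h (ω, X ω) ∂P = ∫⁻ ω, ∫⁻ x, h (ω, x) ∂(κ ω) ∂P := by
    intro h hh
    have h1 := @compProd_map_condDistrib Ω Ω E _ _ _ m P _ id X F hX.aemeasurable
    have h2 : @Measurable Ω (Ω × E) m (F.prod inferInstance) fun ω => (id ω, X ω) :=
      Measurable.prodMk hid hX
    have h3 := @lintegral_map Ω (Ω × E) m (F.prod inferInstance) P h (fun ω => (id ω, X ω)) hh h2
    rw [← h1, @Measure.lintegral_compProd Ω E F _ _ _ _ _ h hh,
      @lintegral_map Ω Ω m F _ _ id ?_ hid] at h3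
    · exact h3.symm
    · exact @Measurable.lintegral_kernel_prod_right' Ω E F _ _ _ h hh
  refine ⟨κ, fun ω => ?_, hlint, fun A hA hXA => ?_, ?_, ?_⟩
  · have : @IsMarkovKernel Ω E F _ (@condDistrib Ω Ω E _ _ _ m F X id P _) := inferInstance
    exact this.isProbabilityMeasure ω
  · have h1 := hlint (fun p => Aᶜ.indicator 1 p.2)
      ((measurable_one.indicator hA.compl).comp measurable_snd)
    have h2 : ∫⁻ ω, Aᶜ.indicator (1 : E → ℝ≥0∞) (X ω) ∂P = 0 := by
      rw [lintegral_congr_ae (g := fun _ => 0), lintegral_zero]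
      filter_upwards [hXA] with ω hω
      simp [hω]
    simp only [h2, lintegral_indicator_one hA.compl] at h1
    have h3 : Measurable fun ω => κ ω Aᶜ := (κ.measurable_coe hA.compl).mono hF le_rfl
    exact (lintegral_eq_zero_iff h3).1 h1.symm
  · have h1 := hlint (fun p => ‖p.2‖ₑ) (measurable_enorm.comp measurable_snd)
    have h2 : Measurable fun ω => ∫⁻ x : E, ‖x‖ₑ ∂(κ ω) :=
      (measurable_enorm.lintegral_kernel (κ := κ)).mono hF le_rfl
    filter_upwards [ae_lt_top h2 (h1 ▸ hi.2.ne)] with ω hω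
    exact ⟨aestronglyMeasurable_id, hω⟩
  · have h1 := @condExp_ae_eq_integral_condDistrib Ω Ω E E _ _ _ _ m P _ id X F _ _ hid
      hX.aemeasurable (fun y => y) stronglyMeasurable_id hi
    rw [MeasurableSpace.comap_id] at h1
    exact h1

/-- The conditional expectation of a variable with values in an open convex set has its values
in that set. -/
theorem condExp_mem_of_isOpen {Ω : Type*} {F m : MeasurableSpace Ω} (hF : F ≤ m)
    (P : Measure Ω) [IsProbabilityMeasure P] {X : Ω → E} (hX : Measurable X)
    (hi : Integrable X P) {K : Set E} (hKo : IsOpen K) (hKc : Convex ℝ K)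
    (hXK : ∀ᵐ ω ∂P, X ω ∈ K) : ∀ᵐ ω ∂P, (P[X | F]) ω ∈ K := by
  obtain ⟨κ, hκ, -, hκm, hκi, hκe⟩ := exists_condKernel hF P hX hi
  filter_upwards [hκm K hKo.measurableSet hXK, hκi, hκe] with ω h1 h2 h3
  rw [h3]
  have := hκ ω
  exact integral_id_mem_of_isOpen hKo hKc h1 h2

/-- Among the `K`-valued estimates of `X` based on the information `F`, the conditional mean has
the smallest expected loss: this is the optimality of the mean, applied to the regular conditional
distribution of `X`. -/
theorem lintegral_loss_condExp_le {S K : Set E} (hS : MeasurableSet S) {l : E → E → ℝ≥0}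
    (hl : IsMeanLoss S K l) {Ω : Type*} {F m : MeasurableSpace Ω} (hF : F ≤ m)
    (P : Measure Ω) [IsProbabilityMeasure P] {X : Ω → E} (hX : Measurable X)
    (hi : Integrable X P) (hXS : ∀ᵐ ω ∂P, X ω ∈ S) {u : Ω → E} (hu : Measurable[F] u)
    (huK : ∀ᵐ ω ∂P, u ω ∈ K) :
    ∫⁻ ω, (l (X ω) ((P[X | F]) ω) : ℝ≥0∞) ∂P ≤ ∫⁻ ω, (l (X ω) (u ω) : ℝ≥0∞) ∂P := by
  obtain ⟨κ, hκ, hκl, hκm, hκi, hκe⟩ := exists_condKernel hF P hX hi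
  have hmeas : ∀ v : Ω → E, Measurable[F] v →
      Measurable[F.prod inferInstance] fun p : Ω × E => (l p.2 (v p.1) : ℝ≥0∞) := fun v hv =>
    measurable_coe_nnreal_ennreal.comp
      (hl.measurable.comp (measurable_snd.prodMk (hv.comp measurable_fst)))
  have h1 := hκl _ (hmeas u hu)
  have h2 := hκl _ (hmeas _ (stronglyMeasurable_condExp (f := X) (μ := P)).measurable)
  simp only at h1 h2
  rw [h1, h2]
  refine lintegral_mono_ae ?_
  filter_upwards [hκm S hS hXS, hκi, hκe, huK] with ω k1 k2 k3 k4
  rw [k3]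
  exact hl.mean_min (κ ω) (hκ ω) (mem_ae_iff.1 k1) k2 (u ω) k4

end Static

/-! ### Bayes' rule for mixtures of two laws -/

section Mixture

open Filter Topology

variable {E : Type*} [NormedAddCommGroup E] [NormedSpace ℝ E]

/-- The posterior weight of `μ₁` in the mixture `a • μ₀ + b • μ₁`. -/
noncomputable def posteriorWeight {Ω : Type*} {F : MeasurableSpace Ω} (μ₀ μ₁ : Measure Ω)
    (a b : ℝ≥0) (ω : Ω) : ℝ :=
  b * (μ₁.rnDeriv μ₀ ω).toReal / (a + b * (μ₁.rnDeriv μ₀ ω).toReal)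

theorem toReal_rnDeriv_mixture {Ω : Type*} {F : MeasurableSpace Ω} (μ₀ μ₁ : Measure Ω)
    [IsFiniteMeasure μ₀] [IsFiniteMeasure μ₁] (a b : ℝ≥0) :
    ∀ᵐ ω ∂μ₀, ((a • μ₀ + b • μ₁).rnDeriv μ₀ ω).toReal
      = a + b * (μ₁.rnDeriv μ₀ ω).toReal := by
  filter_upwards [Measure.rnDeriv_add (a • μ₀) (b • μ₁) μ₀, Measure.rnDeriv_smul_left μ₀ μ₀ a,
    Measure.rnDeriv_smul_left μ₁ μ₀ b, Measure.rnDeriv_self μ₀, Measure.rnDeriv_ne_top μ₁ μ₀]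
    with ω h1 h2 h3 h4 h5
  rw [h1, Pi.add_apply, h2, h3, Pi.smul_apply, Pi.smul_apply, h4, ENNReal.smul_def,
    ENNReal.smul_def, smul_eq_mul, smul_eq_mul, mul_one,
    ENNReal.toReal_add ENNReal.coe_ne_top (ENNReal.mul_ne_top ENNReal.coe_ne_top h5),
    ENNReal.toReal_mul]
  rfl

/-- Bayes' rule for a mixture of two measures: a posterior mean is the combination, with the
posterior weights, of the two individual ones. -/
theorem integral_lineMap_posteriorWeight {Ω : Type*} {F : MeasurableSpace Ω} {μ₀ μ₁ : Measure Ω}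
    [IsFiniteMeasure μ₀] [IsFiniteMeasure μ₁] (hac : μ₁ ≪ μ₀) {a : ℝ≥0} (ha : a ≠ 0) (b : ℝ≥0)
    {f₀ f₁ : Ω → E} (hf₀ : Integrable f₀ μ₀) (hf₁ : Integrable f₁ μ₁) :
    Integrable (fun ω => AffineMap.lineMap (f₀ ω) (f₁ ω) (posteriorWeight μ₀ μ₁ a b ω))
        (a • μ₀ + b • μ₁) ∧
      ∀ A, MeasurableSet A →
        ∫ ω in A, AffineMap.lineMap (f₀ ω) (f₁ ω) (posteriorWeight μ₀ μ₁ a b ω)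
          ∂(a • μ₀ + b • μ₁) = (a : ℝ) • ∫ ω in A, f₀ ω ∂μ₀ + (b : ℝ) • ∫ ω in A, f₁ ω ∂μ₁ := by
  have hac' : a • μ₀ + b • μ₁ ≪ μ₀ :=
    (Measure.AbsolutelyContinuous.rfl.smul_left a).add_left (hac.smul_left b)
  have hi₁ := (integrable_rnDeriv_smul_iff hac).2 hf₁
  have key : (fun ω => ((a • μ₀ + b • μ₁).rnDeriv μ₀ ω).toReal •
        (AffineMap.lineMap (f₀ ω) (f₁ ω) (posteriorWeight μ₀ μ₁ a b ω) : E))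
      =ᵐ[μ₀] fun ω => (a : ℝ) • f₀ ω + (b : ℝ) • (μ₁.rnDeriv μ₀ ω).toReal • f₁ ω := by
    filter_upwards [toReal_rnDeriv_mixture μ₀ μ₁ a b] with ω hω
    rw [hω]
    have hpos : (0 : ℝ) < a + b * (μ₁.rnDeriv μ₀ ω).toReal := by
      have : (0 : ℝ) < a := by exact_mod_cast pos_iff_ne_zero.2 ha
      positivity
    simp only [AffineMap.lineMap_apply_module, posteriorWeight, smul_add, smul_smul]
    congr 2
    · field_simp
      ring
    · field_simp
  have hi : Integrable (fun ω => (a : ℝ) • f₀ ω + (b : ℝ) • (μ₁.rnDeriv μ₀ ω).toReal • f₁ ω) μ₀ :=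
    (hf₀.smul (a : ℝ)).add (hi₁.smul (b : ℝ))
  refine ⟨(integrable_rnDeriv_smul_iff hac').1 (hi.congr key.symm), fun A hA => ?_⟩
  rw [← setIntegral_rnDeriv_smul hac' hA, integral_congr_ae (ae_restrict_of_ae key),
    integral_add (f := fun ω => (a : ℝ) • f₀ ω)
      (g := fun ω => (b : ℝ) • (μ₁.rnDeriv μ₀ ω).toReal • f₁ ω) (hf₀.smul (a : ℝ)).restrict
      (hi₁.smul (b : ℝ)).restrict, integral_smul, integral_smul,
    setIntegral_rnDeriv_smul hac hA]

theorem measurable_posteriorWeight {Ω : Type*} {F : MeasurableSpace Ω} (μ₀ μ₁ : Measure Ω)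
    (a b : ℝ≥0) : Measurable (posteriorWeight μ₀ μ₁ a b) := by
  have h := (Measure.measurable_rnDeriv μ₁ μ₀).ennreal_toReal.const_mul (b : ℝ)
  exact h.div (h.const_add (a : ℝ))

omit [NormedSpace ℝ E] in
/-- An almost sure equality of `F`-measurable variables only depends on the null sets in `F`. -/
theorem ae_eq_of_null_subset {Ω : Type*} {F m : MeasurableSpace Ω} {P Q : @Measure Ω m}
    (hPQ : ∀ A, MeasurableSet[F] A → Q A = 0 → P A = 0) {f g : Ω → E}
    (hf : StronglyMeasurable[F] f) (hg : StronglyMeasurable[F] g) (h : f =ᵐ[Q] g) : f =ᵐ[P] g :=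
  hPQ _ (StronglyMeasurable.measurableSet_eq_fun hf hg).compl h

variable [CompleteSpace E]

/-- Bayes' rule for the conditional expectations of a mixture `a • Q₀ + b • Q₁`, almost surely for
any law `P` that has the null sets of the mixture in `F`. -/
theorem condExp_mixture {Ω : Type*} {F m : MeasurableSpace Ω} (hF : F ≤ m)
    (Q₀ Q₁ : Measure Ω) [IsFiniteMeasure Q₀] [IsFiniteMeasure Q₁]
    (hac : ∀ A, MeasurableSet[F] A → Q₀ A = 0 → Q₁ A = 0) {a : ℝ≥0} (ha : a ≠ 0) (b : ℝ≥0)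
    {X : Ω → E} (h₀ : Integrable X Q₀) (h₁ : Integrable X Q₁) {P : Measure Ω}
    (hP : ∀ A, MeasurableSet[F] A → (a • Q₀ + b • Q₁) A = 0 → P A = 0) :
    (a • Q₀ + b • Q₁)[X | F] =ᵐ[P] fun ω =>
      AffineMap.lineMap ((Q₀[X | F]) ω) ((Q₁[X | F]) ω)
        (posteriorWeight (Q₀.trim hF) (Q₁.trim hF) a b ω) := by
  have htrim : (a • Q₀ + b • Q₁).trim hF = a • Q₀.trim hF + b • Q₁.trim hF := by
    refine @Measure.ext _ F _ _ fun s hs => ?_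
    simp [trim_measurableSet_eq hF hs]
  have hac' : Q₁.trim hF ≪ Q₀.trim hF := by
    refine Measure.AbsolutelyContinuous.mk fun s hs h => ?_
    rw [trim_measurableSet_eq hF hs] at h ⊢
    exact hac s hs h
  have hm : ∀ Q : Measure Ω, StronglyMeasurable[F] (Q[X | F]) := fun Q => stronglyMeasurable_condExp
  have hti : ∀ Q : Measure Ω, Integrable (Q[X | F]) (Q.trim hF) := fun Q =>
    integrable_condExp.trim hF (hm Q)
  obtain ⟨hgi, hgA⟩ := integral_lineMap_posteriorWeight hac' ha b (hti Q₀) (hti Q₁)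
  have hgm : StronglyMeasurable[F] fun ω =>
      (AffineMap.lineMap ((Q₀[X | F]) ω) ((Q₁[X | F]) ω)
        (posteriorWeight (Q₀.trim hF) (Q₁.trim hF) a b ω) : E) := by
    simp only [AffineMap.lineMap_apply_module]
    have hw := (measurable_posteriorWeight (Q₀.trim hF) (Q₁.trim hF) a b).stronglyMeasurable
    exact ((stronglyMeasurable_const.sub hw).smul (hm Q₀)).add (hw.smul (hm Q₁))
  rw [← htrim] at hgi hgA
  refine ae_eq_of_null_subset hP (hm _) hgm
    (ae_eq_condExp_of_forall_setIntegral_eq hF ?_ (fun s _ _ => ?_) (fun s hs _ => ?_)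
    hgm.aestronglyMeasurable).symm
  · exact (h₀.smul_measure_nnreal).add_measure (h₁.smul_measure_nnreal)
  · exact (integrable_of_integrable_trim hF hgi).integrableOn
  · rw [setIntegral_trim hF hgm hs, hgA s hs, ← setIntegral_trim hF (hm _) hs,
      ← setIntegral_trim hF (hm _) hs, setIntegral_condExp hF h₀ hs, setIntegral_condExp hF h₁ hs,
      Measure.restrict_add, integral_add_measure, Measure.restrict_smul, Measure.restrict_smul]
    · simp [NNReal.smul_def]
    · exact h₀.smul_measure_nnreal.integrableOn
    · exact h₁.smul_measure_nnreal.integrableOn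

omit [CompleteSpace E] in
/-- A convex function on an open convex set, of whatever dimension, is continuous along lines. -/
theorem ConvexOn.tendsto_lineMap {K : Set E} (hKo : IsOpen K) {f : E → ℝ} (hf : ConvexOn ℝ K f)
    {u v : E} (hu : u ∈ K) {s : ℕ → ℝ} (hs : Tendsto s atTop (𝓝 0)) :
    Tendsto (fun n => f (AffineMap.lineMap u v (s n))) atTop (𝓝 (f u)) := by
  have h := hf.comp_affineMap (AffineMap.lineMap u v : ℝ →ᵃ[ℝ] E)
  have hcont : Continuous (AffineMap.lineMap u v : ℝ →ᵃ[ℝ] E) := AffineMap.lineMap_continuous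
  have ho : IsOpen ((AffineMap.lineMap u v : ℝ →ᵃ[ℝ] E) ⁻¹' K) := hKo.preimage hcont
  have h0 : (0 : ℝ) ∈ (AffineMap.lineMap u v : ℝ →ᵃ[ℝ] E) ⁻¹' K := by simpa using hu
  have h1 := ((h.continuousOn ho).continuousAt (ho.mem_nhds h0)).tendsto.comp hs
  simpa [Function.comp_def] using h1

theorem tendsto_posteriorWeight {Ω : Type*} {F : MeasurableSpace Ω} (μ₀ μ₁ : Measure Ω)
    {ε : ℕ → ℝ≥0} (hε : Tendsto ε atTop (𝓝 0)) (ω : Ω) :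
    Tendsto (fun n => posteriorWeight μ₀ μ₁ (1 - ε n) (ε n) ω) atTop (𝓝 0) := by
  have h1 : Tendsto (fun n => (ε n : ℝ)) atTop (𝓝 0) := NNReal.tendsto_coe.2 hε
  have h2 : Tendsto (fun n => ((1 - ε n : ℝ≥0) : ℝ)) atTop (𝓝 1) := by
    have := (tendsto_const_nhds (x := (1 : ℝ≥0))).sub hε
    rw [tsub_zero] at this
    exact NNReal.tendsto_coe.2 this
  have h3 := h1.mul_const (μ₁.rnDeriv μ₀ ω).toReal
  have h4 := h3.div (h2.add h3) (by simp)
  simpa [posteriorWeight, Pi.div_def] using h4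

end Mixture

/-! ### A finite minimax theorem for Bayes rules -/

section Game

open Filter Topology

variable {ι : Type*} [Fintype ι]

/-- Nondegenerate probability weights on a finite set: the interior of the standard simplex. -/
def openSimplex (ι : Type*) [Fintype ι] : Set (ι → ℝ) :=
  {w | (∀ i, 0 < w i) ∧ ∑ i, w i = 1}

theorem openSimplex_combo {w v : ι → ℝ} (hw : w ∈ openSimplex ι) (hv : v ∈ openSimplex ι) {ε : ℝ}
    (h0 : 0 ≤ ε) (h1 : ε < 1) : (fun i => (1 - ε) * w i + ε * v i) ∈ openSimplex ι := by
  refine ⟨fun i => ?_, ?_⟩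
  · have := mul_pos (sub_pos.2 h1) (hw.1 i)
    have := mul_nonneg h0 (hv.1 i).le
    positivity
  · rw [Finset.sum_add_distrib, ← Finset.mul_sum, ← Finset.mul_sum, hw.2, hv.2]
    ring

/-- At a maximizer `w` of the Bayes risk `∑ i, w i * b w i` over a set of priors, the risk vector
`b w` of the Bayes rule for `w` has no larger average under any prior `v` from which the
segment to `w` stays in that set. -/
theorem sum_mul_le_of_isMaxOn {b : (ι → ℝ) → ι → ℝ}
    (hopt : ∀ w ∈ openSimplex ι, ∀ w' ∈ openSimplex ι, ∑ i, w i * b w i ≤ ∑ i, w i * b w' i)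
    {w v : ι → ℝ} (hw : w ∈ openSimplex ι) (hv : v ∈ openSimplex ι)
    (hlsc : ∀ i, ∀ c < b w i, ∀ᶠ n : ℕ in atTop,
      c < b (fun i => (1 - 1 / (n + 2 : ℝ)) * w i + 1 / (n + 2 : ℝ) * v i) i)
    (hmax : ∀ n : ℕ, ∑ i, ((1 - 1 / (n + 2 : ℝ)) * w i + 1 / (n + 2 : ℝ) * v i)
        * b (fun i => (1 - 1 / (n + 2 : ℝ)) * w i + 1 / (n + 2 : ℝ) * v i) i
      ≤ ∑ i, w i * b w i) :
    ∑ i, v i * b w i ≤ ∑ i, w i * b w i := by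
  by_contra! hlt
  obtain ⟨η, hη, hη'⟩ : ∃ η > 0, ∑ i, w i * b w i < ∑ i, v i * b w i - η :=
    ⟨(∑ i, v i * b w i - ∑ i, w i * b w i) / 2, by linarith, by linarith⟩
  have hev : ∀ᶠ n : ℕ in atTop, ∀ i, b w i - η
      < b (fun i => (1 - 1 / (n + 2 : ℝ)) * w i + 1 / (n + 2 : ℝ) * v i) i :=
    eventually_all.2 fun i => hlsc i _ (by linarith)
  obtain ⟨n, hn⟩ := hev.exists
  have hm := hmax n
  set ε : ℝ := 1 / (n + 2 : ℝ) with hε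
  have hn2 : (0 : ℝ) < n + 2 := by positivity
  have hε0 : 0 < ε := by positivity
  have hε1 : ε < 1 := by
    rw [hε, div_lt_one hn2]
    linarith [(Nat.cast_nonneg n : (0 : ℝ) ≤ n)]
  set u : ι → ℝ := fun i => (1 - ε) * w i + ε * v i with hu
  have huS : u ∈ openSimplex ι := openSimplex_combo hw hv hε0.le hε1
  have hsplit : ∑ i, u i * b u i = (1 - ε) * ∑ i, w i * b u i + ε * ∑ i, v i * b u i := by
    rw [Finset.mul_sum, Finset.mul_sum, ← Finset.sum_add_distrib]
    exact Finset.sum_congr rfl fun i _ => by simp only [hu]; ring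
  have h1 := hopt w hw u huS
  have h2 : ∑ i, v i * b w i - η ≤ ∑ i, v i * b u i := by
    have : ∑ i, v i * (b w i - η) ≤ ∑ i, v i * b u i :=
      Finset.sum_le_sum fun i _ => mul_le_mul_of_nonneg_left (hn i).le (hv.1 i).le
    simpa [mul_sub, Finset.sum_sub_distrib, ← Finset.sum_mul, hv.2] using this
  change ∑ i, u i * b u i ≤ _ at hm
  rw [hsplit] at hm
  nlinarith

/-- A minimax theorem for Bayes rules: if the Bayes risks of all priors are at most `V`, then some
Bayes rule has all its risks nearly below `V`. Priors bounded away from the boundary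
of the simplex form a compact set on which the Bayes risk, an infimum of linear functions that is
attained, has a maximum; a maximizer does it. -/
theorem exists_forall_le_of_bayesRisk_le [Nonempty ι] {b : (ι → ℝ) → ι → ℝ}
    (h0 : ∀ w ∈ openSimplex ι, ∀ i, 0 ≤ b w i)
    (hopt : ∀ w ∈ openSimplex ι, ∀ w' ∈ openSimplex ι, ∑ i, w i * b w i ≤ ∑ i, w i * b w' i)
    (hlsc : ∀ w ∈ openSimplex ι, ∀ v ∈ openSimplex ι, ∀ i, ∀ c < b w i, ∀ᶠ n : ℕ in atTop,
      c < b (fun i => (1 - 1 / (n + 2 : ℝ)) * w i + 1 / (n + 2 : ℝ) * v i) i)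
    {V : ℝ} (hV : ∀ w ∈ openSimplex ι, ∑ i, w i * b w i ≤ V) {δ : ℝ} (hδ : 0 < δ) :
    ∃ w ∈ openSimplex ι, ∀ i, b w i ≤ V + δ := by
  classical
  set N : ℝ := (Fintype.card ι : ℝ) with hN
  have hNpos : 0 < N := by simp [hN, Fintype.card_pos]
  have hunif : (fun _ : ι => 1 / N) ∈ openSimplex ι :=
    ⟨fun i => by positivity, by simp [← hN, hNpos.ne']⟩
  have hV0 : 0 ≤ V := le_trans
    (Finset.sum_nonneg fun i _ => mul_nonneg (hunif.1 i).le (h0 _ hunif i)) (hV _ hunif)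
  -- this `κ` makes `V / (1 - N * κ) ≤ V + δ`, where `1 - N * κ` is the weight put on one index
  set κ : ℝ := δ / (2 * N * (V + δ)) with hκ
  have hκ0 : 0 < κ := by positivity
  have hNκ : N * κ = δ / (2 * (V + δ)) := by rw [hκ]; field_simp
  have hNκ1 : N * κ < 1 := by
    rw [hNκ, div_lt_one (by positivity)]
    linarith
  let D : Set (ι → ℝ) := {w | (∀ i, κ ≤ w i) ∧ ∑ i, w i = 1}
  have hDS : D ⊆ openSimplex ι := fun w hw => ⟨fun i => hκ0.trans_le (hw.1 i), hw.2⟩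
  have hDc : IsCompact D := by
    refine IsCompact.of_isClosed_subset (isCompact_univ_pi fun _ : ι => isCompact_Icc (a := (0 : ℝ))
      (b := 1)) ?_ fun w hw i _ => ⟨(hDS hw).1 i |>.le, ?_⟩
    · have h1 : IsClosed {w : ι → ℝ | ∀ i, κ ≤ w i} := by
        simp only [ofPred_forall]
        exact isClosed_iInter fun i => isClosed_le continuous_const (continuous_apply i)
      exact h1.inter (isClosed_eq (continuous_finsetSum _ fun i _ => continuous_apply i)
        continuous_const)
    · rw [← hw.2]
      exact Finset.single_le_sum (f := w) (fun i _ => ((hDS hw).1 i).le) (Finset.mem_univ i)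
  have hDne : D.Nonempty := ⟨_, fun i => by
    rw [le_div_iff₀ hNpos]
    linarith, hunif.2⟩
  have husc : UpperSemicontinuousOn (fun w : ι → ℝ => ∑ i, w i * b w i) D := by
    intro w hw y hy
    have hc : Continuous fun w' : ι → ℝ => ∑ i, w' i * b w i := by fun_prop
    have hev : ∀ᶠ w' in 𝓝[D] w, ∑ i, w' i * b w i < y :=
      (hc.tendsto w).eventually_lt_const hy |>.filter_mono nhdsWithin_le_nhds
    filter_upwards [hev, self_mem_nhdsWithin] with w' h1 h2
    exact (hopt w' (hDS h2) w (hDS hw)).trans_lt h1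
  obtain ⟨w, hwD, hwmax⟩ := husc.exists_isMaxOn hDne hDc
  refine ⟨w, hDS hwD, fun i => ?_⟩
  let v : ι → ℝ := fun j => κ + if j = i then 1 - N * κ else 0
  have hvD : v ∈ D := by
    refine ⟨fun j => ?_, ?_⟩
    · simp only [v]
      split_ifs <;> linarith
    · simp [v, Finset.sum_add_distrib, ← hN]
  have hle : ∑ j, v j * b w j ≤ ∑ j, w j * b w j := by
    refine sum_mul_le_of_isMaxOn hopt (hDS hwD) (hDS hvD) (hlsc w (hDS hwD) v (hDS hvD))
      fun n => hwmax ⟨fun j => ?_, ?_⟩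
    · have h1 : (0 : ℝ) ≤ 1 / (n + 2 : ℝ) := by positivity
      have h2 : 1 / (n + 2 : ℝ) ≤ 1 := by
        rw [div_le_one (by positivity)]
        linarith [(Nat.cast_nonneg n : (0 : ℝ) ≤ n)]
      nlinarith [hwD.1 j, hvD.1 j]
    · rw [Finset.sum_add_distrib, ← Finset.mul_sum, ← Finset.mul_sum, hwD.2, hvD.2]
      ring
  have h1 : v i * b w i ≤ V := (Finset.single_le_sum (f := fun j => v j * b w j)
    (fun j _ => mul_nonneg ((hDS hvD).1 j).le (h0 w (hDS hwD) j)) (Finset.mem_univ i)).trans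
    (hle.trans (hV w (hDS hwD)))
  have h2 : (1 - N * κ) * b w i ≤ V := by
    refine le_trans (mul_le_mul_of_nonneg_right ?_ (h0 w (hDS hwD) i)) h1
    simp [v, hκ0.le]
  rw [hNκ] at h2
  have h3 : (2 * V + δ) * b w i ≤ 2 * V * (V + δ) := by
    have h4 : 1 - δ / (2 * (V + δ)) = (2 * V + δ) / (2 * (V + δ)) := by field_simp; ring
    rw [h4, div_mul_eq_mul_div, div_le_iff₀ (by positivity)] at h2
    linarith
  by_contra! hlt
  nlinarith

end Game

/-! ### Bayesian filters -/

section Filters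

open Filter Topology

variable {Ω 𝒴 : Type*} [mΩ : MeasurableSpace Ω] [MeasurableSpace 𝒴]

omit mΩ in
theorem obs_mono (Y : ℝ → Ω → 𝒴) : Monotone (obs Y) := fun _ _ hst =>
  biSup_mono fun _ hr => ⟨hr.1, hr.2.trans hst⟩

theorem obs_le {T : ℝ} {Y : ℝ → Ω → 𝒴} (hY : ∀ t ∈ Icc 0 T, Measurable (Y t)) {t : ℝ}
    (ht : t ≤ T) : obs Y t ≤ mΩ :=
  iSup₂_le fun s hs => (hY s ⟨hs.1, hs.2.trans ht⟩).comap_le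

/-- The filtration generated by the observations, stopped at the horizon `T`, since `Y` is only
assumed measurable up to that time. -/
def obsFiltration {T : ℝ} {Y : ℝ → Ω → 𝒴} (hY : ∀ t ∈ Icc 0 T, Measurable (Y t)) :
    Filtration ℝ mΩ where
  seq t := obs Y (min t T)
  mono' _ _ hst := obs_mono Y (min_le_min_right T hst)
  le' _ := obs_le hY (min_le_right _ _)

theorem obsFiltration_eq {T : ℝ} {Y : ℝ → Ω → 𝒴} (hY : ∀ t ∈ Icc 0 T, Measurable (Y t)) {t : ℝ}
    (ht : t ≤ T) : obsFiltration hY t = obs Y t := by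
  change obs Y (min t T) = obs Y t
  rw [min_eq_left ht]

variable {E : Type*} [NormedAddCommGroup E] [NormedSpace ℝ E] [CompleteSpace E]
  [SecondCountableTopology E] [MeasurableSpace E] [BorelSpace E]
  {S K : Set E} {l : E → E → ℝ≥0} {T : ℝ} {X Z : ℝ → Ω → E} {Y : ℝ → Ω → 𝒴} {P Q : Measure Ω}

theorem exists_isBayesFilter (hT : 0 ≤ T) (hSK : S ⊆ K) (hKo : IsOpen K) (hKc : Convex ℝ K)
    (hX : Measurable (Function.uncurry X)) (hXS : ∀ t ∈ Icc 0 T, ∀ ω, X t ω ∈ S)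
    (hY : ∀ t ∈ Icc 0 T, Measurable (Y t)) [IsProbabilityMeasure Q]
    (hint : Integrable (Function.uncurry X) ((volume.restrict (Icc 0 T)).prod Q)) :
    ∃ Z, IsBayesFilter T K X Y Q Z := by
  classical
  let ℱ := obsFiltration hY
  let W : ℝ × Ω → E :=
    ((volume.restrict (Icc 0 T)).prod Q)[Function.uncurry X | adaptedSigma ℱ]
  obtain ⟨ω₀⟩ := nonempty_of_isProbabilityMeasure Q
  let k₀ : E := X 0 ω₀
  have hk₀ : k₀ ∈ K := hSK (hXS 0 ⟨le_rfl, hT⟩ ω₀)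
  have hWm : StronglyMeasurable[adaptedSigma ℱ] W := stronglyMeasurable_condExp
  -- outside `K`, the conditional expectation is replaced by a fixed element of `K`
  let Z : ℝ × Ω → E := fun p => if W p ∈ K then W p else k₀
  have hZm : Measurable[adaptedSigma ℱ] Z := by
    let := adaptedSigma ℱ
    exact Measurable.ite (hWm.measurable hKo.measurableSet) hWm.measurable measurable_const
  refine ⟨fun t ω => Z (t, ω), ⟨hZm.mono (adaptedSigma_le ℱ) le_rfl, fun t ht => ?_,
    fun t _ ω => ?_⟩, ?_⟩
  · have := hZm.comp (measurable_prodMk_adaptedSigma ℱ t)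
    rwa [obsFiltration_eq hY ht.2] at this
  · by_cases h : W (t, ω) ∈ K
    · simpa only [Z, if_pos h] using h
    · simpa only [Z, if_neg h] using hk₀
  · filter_upwards [hasAdaptedProjection (ℱ := ℱ) hint, hint.prod_right_ae,
      ae_restrict_mem measurableSet_Icc] with t h1 h2 ht
    have hXt : Measurable (X t) := hX.comp measurable_prodMk_left
    have h3 := condExp_mem_of_isOpen (obs_le hY ht.2) Q hXt h2 hKo hKc
      (.of_forall fun ω => hSK (hXS t ht ω))
    rw [obsFiltration_eq hY ht.2] at h1
    filter_upwards [h1, h3] with ω k1 k2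
    have k3 : W (t, ω) = (Q[X t | obs Y t]) ω := k1
    simp only [Z, k3, if_pos k2]

omit [NormedAddCommGroup E] [NormedSpace ℝ E] [CompleteSpace E] [SecondCountableTopology E]
  [BorelSpace E] in
theorem measurable_loss (hl : Measurable (Function.uncurry l))
    (hX : Measurable (Function.uncurry X)) (hZ : Measurable (Function.uncurry Z)) :
    Measurable fun p : ℝ × Ω => (l (X p.1 p.2) (Z p.1 p.2) : ℝ≥0∞) :=
  measurable_coe_nnreal_ennreal.comp (hl.comp (hX.prodMk hZ))

omit [NormedAddCommGroup E] [NormedSpace ℝ E] [CompleteSpace E] [SecondCountableTopology E]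
  [BorelSpace E] in
theorem cmle_eq_lintegral_lintegral (hl : Measurable (Function.uncurry l))
    (hX : Measurable (Function.uncurry X)) (hZ : Measurable (Function.uncurry Z)) [SFinite P] :
    cmle T l X P Z = ∫⁻ t in Icc 0 T, ∫⁻ ω, (l (X t ω) (Z t ω) : ℝ≥0∞) ∂P :=
  lintegral_lintegral_swap ((measurable_loss hl hX hZ).comp measurable_swap).aemeasurable

theorem IsBayesFilter.ae_ae_eq (hZ : IsBayesFilter T K X Y Q Z)
    (hPQ : ∀ t ∈ Icc 0 T, ∀ A, MeasurableSet[obs Y t] A → Q A = 0 → P A = 0) :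
    ∀ᵐ t ∂(volume.restrict (Icc 0 T)), Z t =ᵐ[P] Q[X t | obs Y t] := by
  filter_upwards [hZ.ae_eq, ae_restrict_mem measurableSet_Icc] with t h ht
  exact ae_eq_of_null_subset (hPQ t ht)
    (hZ.isCausalFilter.causal t ht).stronglyMeasurable stronglyMeasurable_condExp h

/-- The error of a Bayesian filter for `Q` under a law `P` that is dominated by `Q` on the
observations does not depend on the filter. -/
theorem IsBayesFilter.cmle_eq (hZ : IsBayesFilter T K X Y Q Z)
    (hl : Measurable (Function.uncurry l)) (hX : Measurable (Function.uncurry X)) [SFinite P]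
    (hPQ : ∀ t ∈ Icc 0 T, ∀ A, MeasurableSet[obs Y t] A → Q A = 0 → P A = 0) :
    cmle T l X P Z = cmleBayes T l X Y P Q := by
  rw [cmle_eq_lintegral_lintegral hl hX hZ.isCausalFilter.measurable, cmleBayes]
  refine lintegral_congr_ae ?_
  filter_upwards [hZ.ae_ae_eq hPQ] with t ht
  refine lintegral_congr_ae ?_
  filter_upwards [ht] with ω hω
  rw [hω]

theorem IsBayesFilter.cmle_le {Z' : ℝ → Ω → E} (hZ : IsBayesFilter T K X Y Q Z)
    (hZ' : IsCausalFilter T K Y Z') (hS : MeasurableSet S) (hl : IsMeanLoss S K l)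
    (hX : Measurable (Function.uncurry X)) (hXS : ∀ t ∈ Icc 0 T, ∀ ω, X t ω ∈ S)
    (hY : ∀ t ∈ Icc 0 T, Measurable (Y t)) [IsProbabilityMeasure Q]
    (hint : Integrable (Function.uncurry X) ((volume.restrict (Icc 0 T)).prod Q)) :
    cmle T l X Q Z ≤ cmle T l X Q Z' := by
  rw [hZ.cmle_eq hl.measurable hX fun _ _ _ _ h => h,
    cmle_eq_lintegral_lintegral hl.measurable hX hZ'.measurable, cmleBayes]
  refine lintegral_mono_ae ?_
  filter_upwards [hint.prod_right_ae, ae_restrict_mem measurableSet_Icc] with t h2 ht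
  exact lintegral_loss_condExp_le hS hl (obs_le hY ht.2) Q (hX.comp measurable_prodMk_left) h2
    (.of_forall fun ω => hXS t ht ω) (hZ'.causal t ht) (.of_forall fun ω => hZ'.mem t ht ω)

/-- The mismatched error is lower semicontinuous along segments of laws. By Bayes' rule the
conditional means of the mixtures stay on a segment, and the loss is
continuous along it; then Fatou's lemma applies. -/
theorem cmleBayes_le_liminf (hT : 0 ≤ T) (hSK : S ⊆ K) (hKo : IsOpen K) (hKc : Convex ℝ K)
    (hl : IsMeanLoss S K l)
    (hX : Measurable (Function.uncurry X)) (hXS : ∀ t ∈ Icc 0 T, ∀ ω, X t ω ∈ S)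
    (hY : ∀ t ∈ Icc 0 T, Measurable (Y t)) [IsProbabilityMeasure P]
    {Q₀ Q₁ : Measure Ω} [IsProbabilityMeasure Q₀] [IsProbabilityMeasure Q₁]
    (h₀ : Integrable (Function.uncurry X) ((volume.restrict (Icc 0 T)).prod Q₀))
    (h₁ : Integrable (Function.uncurry X) ((volume.restrict (Icc 0 T)).prod Q₁))
    (hP₀ : ∀ t ∈ Icc 0 T, ∀ A, MeasurableSet[obs Y t] A → Q₀ A = 0 → P A = 0)
    (h₀₁ : ∀ t ∈ Icc 0 T, ∀ A, MeasurableSet[obs Y t] A → Q₀ A = 0 → Q₁ A = 0)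
    {ε : ℕ → ℝ≥0} (hε1 : ∀ n, ε n < 1) (hε : Tendsto ε atTop (𝓝 0)) :
    cmleBayes T l X Y P Q₀
      ≤ liminf (fun n => cmleBayes T l X Y P ((1 - ε n) • Q₀ + ε n • Q₁)) atTop := by
  let Q : ℕ → Measure Ω := fun n => (1 - ε n) • Q₀ + ε n • Q₁
  have ha : ∀ n, 1 - ε n ≠ 0 := fun n => (tsub_pos_of_lt (hε1 n)).ne'
  have hQp : ∀ n, IsProbabilityMeasure (Q n) := fun n => ⟨by
    simp only [Q, Measure.add_apply, Measure.smul_apply, measure_univ, ENNReal.smul_def,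
      smul_eq_mul, mul_one]
    rw [← ENNReal.coe_add, tsub_add_cancel_of_le (hε1 n).le, ENNReal.coe_one]⟩
  have hQi : ∀ n, Integrable (Function.uncurry X) ((volume.restrict (Icc 0 T)).prod (Q n)) := by
    intro n
    simp only [Q, Measure.prod_add, Measure.prod_smul_right]
    exact h₀.smul_measure_nnreal.add_measure h₁.smul_measure_nnreal
  have hPQ : ∀ n, ∀ t ∈ Icc 0 T, ∀ A, MeasurableSet[obs Y t] A → Q n A = 0 → P A = 0 := by
    intro n t ht A hA h
    refine hP₀ t ht A hA ?_
    simp only [Q, Measure.add_apply, Measure.smul_apply, add_eq_zero] at h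
    rw [ENNReal.smul_def, smul_eq_mul, mul_eq_zero] at h
    exact h.1.resolve_left (by exact_mod_cast ha n)
  obtain ⟨Z₀, hZ₀⟩ := exists_isBayesFilter hT hSK hKo hKc hX hXS hY h₀
  choose Z hZ using fun n => exists_isBayesFilter hT hSK hKo hKc hX hXS hY (hQi n)
  have heq : ∀ n, cmleBayes T l X Y P ((1 - ε n) • Q₀ + ε n • Q₁)
      = ∫⁻ t in Icc 0 T, ∫⁻ ω, (l (X t ω) (Z n t ω) : ℝ≥0∞) ∂P := fun n => by
    rw [← cmle_eq_lintegral_lintegral hl.measurable hX (hZ n).isCausalFilter.measurable]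
    exact ((hZ n).cmle_eq hl.measurable hX (hPQ n)).symm
  simp_rw [heq]
  have hmeas : ∀ n, Measurable fun p : ℝ × Ω => (l (X p.1 p.2) (Z n p.1 p.2) : ℝ≥0∞) :=
    fun n => measurable_loss hl.measurable hX (hZ n).isCausalFilter.measurable
  refine le_trans (lintegral_mono_ae ?_)
    (lintegral_liminf_le fun n => (hmeas n).lintegral_prod_right')
  filter_upwards [hZ₀.ae_ae_eq hP₀, ae_all_iff.2 fun n => (hZ n).ae_ae_eq (hPQ n),
    h₀.prod_right_ae, h₁.prod_right_ae, ae_restrict_mem measurableSet_Icc] with t k1 k2 k3 k4 ht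
  refine le_trans (lintegral_mono_ae ?_)
    (lintegral_liminf_le fun n => (hmeas n).comp measurable_prodMk_left)
  have hF := obs_le hY ht.2
  have i₀ : Integrable (X t) Q₀ := k3
  have i₁ : Integrable (X t) Q₁ := k4
  have k5 := ae_all_iff.2 fun n => condExp_mixture hF Q₀ Q₁ (h₀₁ t ht) (ha n)
    (ε n) i₀ i₁ (hPQ n t ht)
  filter_upwards [k1, ae_all_iff.2 k2, k5] with ω m1 m2 m3
  have hmem : (Q₀[X t | obs Y t]) ω ∈ K := m1 ▸ hZ₀.isCausalFilter.mem t ht ω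
  have hlim := (hl.convex (X t ω) (hXS t ht ω)).tendsto_lineMap hKo
    (v := (Q₁[X t | obs Y t]) ω) hmem
    (tendsto_posteriorWeight (Q₀.trim hF) (Q₁.trim hF) hε ω)
  have hlim' : Tendsto (fun n => (l (X t ω) (Z n t ω) : ℝ≥0∞)) atTop
      (𝓝 (l (X t ω) ((Q₀[X t | obs Y t]) ω))) := by
    refine ENNReal.tendsto_coe.2 (NNReal.tendsto_coe.1 (hlim.congr fun n => ?_))
    rw [m2 n]
    exact congrArg (fun u => (l (X t ω) u : ℝ)) (m3 n).symm
  exact hlim'.liminf_eq.ge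

end Filters

/-! ### Mixtures of laws and the minimax regret -/

section ConvexHull

/-- `Convex.sum_mem` for convexity over the semiring `ℝ≥0`. -/
theorem Convex.sum_mem_nnreal {M ι : Type*} [AddCommMonoid M] [Module ℝ≥0 M] {C : Set M}
    (hC : Convex ℝ≥0 C) (s : Finset ι) {c : ι → ℝ≥0} {x : ι → M} (hx : ∀ i ∈ s, x i ∈ C)
    (hc : ∑ i ∈ s, c i = 1) : ∑ i ∈ s, c i • x i ∈ C := by
  classical
  have key : ∀ s : Finset ι, (∀ i ∈ s, x i ∈ C) → ∑ i ∈ s, c i ≠ 0 →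
      (∑ i ∈ s, c i)⁻¹ • ∑ i ∈ s, c i • x i ∈ C := by
    intro s
    induction s using Finset.induction_on with
    | empty => simp
    | insert i s hi ih =>
      intro hx hne
      rw [Finset.sum_insert hi] at hne ⊢
      rw [Finset.sum_insert hi]
      by_cases h0 : ∑ j ∈ s, c j = 0
      · have h1 : ∑ j ∈ s, c j • x j = 0 := Finset.sum_eq_zero fun j hj => by
          rw [(Finset.sum_eq_zero_iff.1 h0) j hj, zero_smul]
        rw [h0, add_zero] at hne ⊢
        rw [h1, add_zero, smul_smul, inv_mul_cancel₀ hne, one_smul]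
        exact hx i (Finset.mem_insert_self i s)
      · have h2 := hC (hx i (Finset.mem_insert_self i s))
          (ih (fun j hj => hx j (Finset.mem_insert_of_mem hj)) h0)
          (a := (c i + ∑ j ∈ s, c j)⁻¹ * c i) (b := (c i + ∑ j ∈ s, c j)⁻¹ * ∑ j ∈ s, c j)
          zero_le zero_le (by rw [← mul_add, inv_mul_cancel₀ hne])
        rw [smul_smul, mul_assoc, mul_inv_cancel₀ h0, mul_one] at h2
        rwa [smul_add, smul_smul]
  have h := key s hx (by simp [hc])
  rwa [hc, inv_one, one_smul] at h

end ConvexHull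

section Model

open Filter Topology

variable {Ω 𝒴 Θ : Type*} [MeasurableSpace Ω] [MeasurableSpace 𝒴]
  {E : Type*} [NormedAddCommGroup E] [NormedSpace ℝ E] [CompleteSpace E]
  [SecondCountableTopology E] [MeasurableSpace E] [BorelSpace E]

/-- The standing assumptions on the alphabets, the loss, the processes and the uncertainty set of
laws, except for the compactness of the set of mixtures. -/
structure IsFilteringModel (S K : Set E) (l : E → E → ℝ≥0) (T : ℝ) (X : ℝ → Ω → E)
    (Y : ℝ → Ω → 𝒴) (P : Θ → Measure Ω) : Prop where
  measurableSet : MeasurableSet S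
  subset : S ⊆ K
  isOpen : IsOpen K
  convex : Convex ℝ K
  loss : IsMeanLoss S K l
  nonneg : 0 ≤ T
  signal : Measurable (Function.uncurry X)
  signal_mem : ∀ t ∈ Icc 0 T, ∀ ω, X t ω ∈ S
  obs : ∀ t ∈ Icc 0 T, Measurable (Y t)
  prob : ∀ θ, IsProbabilityMeasure (P θ)
  integrable : ∀ θ, Integrable (Function.uncurry X) ((volume.restrict (Icc 0 T)).prod (P θ))
  finite : ∀ θ, cmleBayes T l X Y (P θ) (P θ) ≠ ∞
  null : ∀ θ θ', ∀ t ∈ Icc 0 T, ∀ A, MeasurableSet[_root_.obs Y t] A → P θ' A = 0 → P θ A = 0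

/-- The properties shared by all mixtures of the laws `P θ`. -/
structure IsMixtureLaw (T : ℝ) (X : ℝ → Ω → E) (Y : ℝ → Ω → 𝒴) (P : Θ → Measure Ω)
    (Q : Measure Ω) : Prop where
  prob : IsProbabilityMeasure Q
  integrable : Integrable (Function.uncurry X) ((volume.restrict (Icc 0 T)).prod Q)
  null_iff : ∀ θ, ∀ t ∈ Icc 0 T, ∀ A, MeasurableSet[obs Y t] A → (Q A = 0 ↔ P θ A = 0)

variable {S K : Set E} {l : E → E → ℝ≥0} {T : ℝ} {X : ℝ → Ω → E} {Y : ℝ → Ω → 𝒴}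
  {P : Θ → Measure Ω} {Q : Measure Ω}

namespace IsFilteringModel

omit [SecondCountableTopology E] [BorelSpace E] in
theorem isMixtureLaw (H : IsFilteringModel S K l T X Y P)
    (hQ : Q ∈ convexHull ℝ≥0 (range P)) : IsMixtureLaw T X Y P Q := by
  refine convexHull_min (t := {Q | IsMixtureLaw T X Y P Q}) ?_ ?_ hQ
  · rintro _ ⟨θ, rfl⟩
    exact ⟨H.prob θ, H.integrable θ, fun θ' t ht A hA =>
      ⟨H.null θ' θ t ht A hA, H.null θ θ' t ht A hA⟩⟩
  · intro Q₁ h₁ Q₂ h₂ a b _ _ hab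
    have := h₁.prob
    have := h₂.prob
    refine ⟨⟨?_⟩, ?_, fun θ t ht A hA => ?_⟩
    · simp only [Measure.add_apply, Measure.smul_apply, measure_univ, ENNReal.smul_def,
        smul_eq_mul, mul_one]
      rw [← ENNReal.coe_add, hab, ENNReal.coe_one]
    · simp only [Measure.prod_add, Measure.prod_smul_right]
      exact h₁.integrable.smul_measure_nnreal.add_measure h₂.integrable.smul_measure_nnreal
    · simp only [Measure.add_apply, Measure.smul_apply, ENNReal.smul_def, smul_eq_mul, add_eq_zero,
        mul_eq_zero, ENNReal.coe_eq_zero, h₁.null_iff θ t ht A hA, h₂.null_iff θ t ht A hA]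
      refine ⟨fun h => ?_, fun h => ⟨.inr h, .inr h⟩⟩
      rcases h.1 with h0 | h0
      · refine h.2.resolve_left fun h1 => ?_
        simp [h0, h1] at hab
      · exact h0

theorem exists_isBayesFilter (H : IsFilteringModel S K l T X Y P)
    (hQ : IsMixtureLaw T X Y P Q) : ∃ Z, IsBayesFilter T K X Y Q Z :=
  have := hQ.prob
  _root_.exists_isBayesFilter H.nonneg H.subset H.isOpen H.convex H.signal H.signal_mem H.obs
    hQ.integrable

theorem cmle_eq (H : IsFilteringModel S K l T X Y P) (hQ : IsMixtureLaw T X Y P Q)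
    {Z : ℝ → Ω → E} (hZ : IsBayesFilter T K X Y Q Z) (θ : Θ) :
    cmle T l X (P θ) Z = cmleBayes T l X Y (P θ) Q :=
  have := H.prob θ
  hZ.cmle_eq H.loss.measurable H.signal fun t ht A hA => (hQ.null_iff θ t ht A hA).1

theorem cmle_le (H : IsFilteringModel S K l T X Y P) (hQ : IsMixtureLaw T X Y P Q)
    {Z Z' : ℝ → Ω → E} (hZ : IsBayesFilter T K X Y Q Z) (hZ' : IsCausalFilter T K Y Z') :
    cmle T l X Q Z ≤ cmle T l X Q Z' :=
  have := hQ.prob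
  hZ.cmle_le hZ' H.measurableSet H.loss H.signal H.signal_mem H.obs hQ.integrable

theorem cmleBayes_self_le_cmle (H : IsFilteringModel S K l T X Y P) (θ : Θ) {Z : ℝ → Ω → E}
    (hZ : IsCausalFilter T K Y Z) : cmleBayes T l X Y (P θ) (P θ) ≤ cmle T l X (P θ) Z := by
  have h := H.isMixtureLaw (subset_convexHull ℝ≥0 (range P) (mem_range_self θ))
  obtain ⟨Z', hZ'⟩ := H.exists_isBayesFilter h
  rw [← H.cmle_eq h hZ']
  exact H.cmle_le h hZ' hZ

theorem cmleBayes_self_le (H : IsFilteringModel S K l T X Y P) (θ : Θ)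
    (hQ : IsMixtureLaw T X Y P Q) :
    cmleBayes T l X Y (P θ) (P θ) ≤ cmleBayes T l X Y (P θ) Q := by
  obtain ⟨Z, hZ⟩ := H.exists_isBayesFilter hQ
  rw [← H.cmle_eq hQ hZ]
  exact H.cmleBayes_self_le_cmle θ hZ.isCausalFilter

theorem regret_eq (H : IsFilteringModel S K l T X Y P) (hQ : IsMixtureLaw T X Y P Q)
    {Z : ℝ → Ω → E} (hZ : IsBayesFilter T K X Y Q Z) (θ : Θ) :
    regret T l X Y (P θ) Z = regretBayes T l X Y (P θ) Q := by
  rw [regret, regretBayes, H.cmle_eq hQ hZ]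

theorem minimaxRegret_le (H : IsFilteringModel S K l T X Y P) (hQ : IsMixtureLaw T X Y P Q) :
    minimaxRegret T K l X Y P ≤ ⨆ θ, regretBayes T l X Y (P θ) Q := by
  obtain ⟨Z, hZ⟩ := H.exists_isBayesFilter hQ
  refine (iInf₂_le Z hZ.isCausalFilter).trans ?_
  simp_rw [H.regret_eq hQ hZ]
  exact le_rfl

end IsFilteringModel

theorem EReal.coe_ennreal_sub_coe_ennreal {a c : ℝ≥0∞} (ha : a ≠ ∞) (hc : c ≠ ∞) :
    (a : EReal) - c = ((a.toReal - c.toReal : ℝ) : EReal) := by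
  lift a to ℝ≥0 using ha
  lift c to ℝ≥0 using hc
  rfl

theorem EReal.top_sub_coe_ennreal {c : ℝ≥0∞} (hc : c ≠ ∞) : ((∞ : ℝ≥0∞) : EReal) - c = ⊤ := by
  lift c to ℝ≥0 using hc
  rfl

theorem EReal.coe_ennreal_sub_nonneg {a c : ℝ≥0∞} (hc : c ≠ ∞) (h : c ≤ a) :
    0 ≤ (a : EReal) - c := by
  by_cases ha : a = ∞
  · rw [ha, EReal.top_sub_coe_ennreal hc]
    exact le_top
  · rw [EReal.coe_ennreal_sub_coe_ennreal ha hc]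
    exact_mod_cast _root_.sub_nonneg.2 (ENNReal.toReal_mono ha h)

theorem IsFilteringModel.minimaxRegret_nonneg [Nonempty Θ] (H : IsFilteringModel S K l T X Y P) :
    0 ≤ minimaxRegret T K l X Y P :=
  le_iInf₂ fun _ hZ => le_iSup_of_le (Classical.arbitrary Θ)
    (EReal.coe_ennreal_sub_nonneg (H.finite _) (H.cmleBayes_self_le_cmle _ hZ))

/-- The mixture of finitely many laws with the given weights. -/
noncomputable def mixture {ι : Type*} [Fintype ι] (P : ι → Measure Ω) (w : ι → ℝ) : Measure Ω :=
  ∑ i, (w i).toNNReal • P i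

theorem mixture_mem_convexHull {ι : Type*} [Fintype ι] {P : ι → Measure Ω} {R : Set (Measure Ω)}
    (hP : ∀ i, P i ∈ R) {w : ι → ℝ} (hw : w ∈ openSimplex ι) :
    mixture P w ∈ convexHull ℝ≥0 R := by
  refine (convex_convexHull ℝ≥0 R).sum_mem_nnreal _ (fun i _ => subset_convexHull _ _ (hP i)) ?_
  rw [← Real.toNNReal_sum_of_nonneg fun i _ => (hw.1 i).le, hw.2, Real.toNNReal_one]

theorem mixture_combo {ι : Type*} [Fintype ι] (P : ι → Measure Ω) {w v : ι → ℝ}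
    (hw : w ∈ openSimplex ι) (hv : v ∈ openSimplex ι) {ε : ℝ≥0} (hε : ε ≤ 1) :
    mixture P (fun i => (1 - (ε : ℝ)) * w i + ε * v i)
      = (1 - ε) • mixture P w + ε • mixture P v := by
  rw [mixture, mixture, mixture, Finset.smul_sum, Finset.smul_sum, ← Finset.sum_add_distrib]
  refine Finset.sum_congr rfl fun i _ => ?_
  rw [smul_smul, smul_smul, ← add_smul]
  congr 1
  have h1 : (0 : ℝ) ≤ 1 - ε := sub_nonneg.2 (by exact_mod_cast hε)
  have h2 : (0 : ℝ) ≤ (1 - ε) * w i + ε * v i :=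
    add_nonneg (mul_nonneg h1 (hw.1 i).le) (mul_nonneg ε.coe_nonneg (hv.1 i).le)
  refine NNReal.eq ?_
  rw [Real.coe_toNNReal _ h2]
  simp [NNReal.coe_sub hε, (hw.1 i).le, (hv.1 i).le]

omit [NormedAddCommGroup E] [NormedSpace ℝ E] [CompleteSpace E] [SecondCountableTopology E]
  [MeasurableSpace E] [BorelSpace E] in
theorem cmle_mixture {ι : Type*} [Fintype ι] (P : ι → Measure Ω) (w : ι → ℝ) (Z : ℝ → Ω → E) :
    cmle T l X (mixture P w) Z = ∑ i, ENNReal.ofReal (w i) * cmle T l X (P i) Z := by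
  simp only [cmle, mixture, lintegral_finsetSum_measure, lintegral_smul_measure]
  rfl

theorem toReal_sum_ofReal_mul {ι : Type*} [Fintype ι] {w : ι → ℝ} (hw : ∀ i, 0 ≤ w i)
    {x : ι → ℝ≥0∞} (hx : ∀ i, x i ≠ ∞) :
    (∑ i, ENNReal.ofReal (w i) * x i).toReal = ∑ i, w i * (x i).toReal := by
  rw [ENNReal.toReal_sum fun i _ => ENNReal.mul_ne_top ENNReal.ofReal_ne_top (hx i)]
  refine Finset.sum_congr rfl fun i _ => ?_
  rw [ENNReal.toReal_mul, ENNReal.toReal_ofReal (hw i)]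

namespace IsFilteringModel

variable {ι : Type*} [Fintype ι]

/-- If some causal filter has finite errors, so have the Bayesian filters for nondegenerate
mixtures. -/
theorem cmleBayes_mixture_ne_top (H : IsFilteringModel S K l T X Y P) {j : ι → Θ}
    {Z : ℝ → Ω → E} (hZ : IsCausalFilter T K Y Z) (hZfin : ∀ i, cmle T l X (P (j i)) Z ≠ ∞)
    {w : ι → ℝ} (hw : w ∈ openSimplex ι) (i : ι) :
    cmleBayes T l X Y (P (j i)) (mixture (P ∘ j) w) ≠ ∞ := by
  have hQ := H.isMixtureLaw (mixture_mem_convexHull (P := P ∘ j) (fun i => mem_range_self (j i)) hw)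
  obtain ⟨Z', hZ'⟩ := H.exists_isBayesFilter hQ
  have h := H.cmle_le hQ hZ' hZ
  rw [cmle_mixture, cmle_mixture] at h
  have h1 : ∑ i, ENNReal.ofReal (w i) * cmle T l X ((P ∘ j) i) Z ≠ ∞ :=
    ENNReal.sum_ne_top.2 fun i _ => ENNReal.mul_ne_top ENNReal.ofReal_ne_top (hZfin i)
  have h2 := (ENNReal.sum_ne_top.1 (ne_top_of_le_ne_top h1 h)) i (Finset.mem_univ i)
  rw [← H.cmle_eq hQ hZ']
  intro h3
  refine h2 ?_
  rw [Function.comp_apply, h3, ENNReal.mul_top]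
  simpa using hw.1 i

/-- Optimality of the Bayesian filter for a nondegenerate mixture, in terms of real numbers. -/
theorem sum_mul_cmleBayes_le (H : IsFilteringModel S K l T X Y P) {j : ι → Θ}
    {Z : ℝ → Ω → E} (hZ : IsCausalFilter T K Y Z) (hZfin : ∀ i, cmle T l X (P (j i)) Z ≠ ∞)
    {w : ι → ℝ} (hw : w ∈ openSimplex ι) :
    ∑ i, w i * (cmleBayes T l X Y (P (j i)) (mixture (P ∘ j) w)).toReal
      ≤ ∑ i, w i * (cmle T l X (P (j i)) Z).toReal := by
  have hQ := H.isMixtureLaw (mixture_mem_convexHull (P := P ∘ j) (fun i => mem_range_self (j i)) hw)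
  obtain ⟨Z', hZ'⟩ := H.exists_isBayesFilter hQ
  have h := H.cmle_le hQ hZ' hZ
  rw [cmle_mixture, cmle_mixture] at h
  simp only [Function.comp_apply, H.cmle_eq hQ hZ'] at h
  have hw0 : ∀ i, 0 ≤ w i := fun i => (hw.1 i).le
  rw [← toReal_sum_ofReal_mul hw0 (H.cmleBayes_mixture_ne_top hZ hZfin hw),
    ← toReal_sum_ofReal_mul hw0 hZfin]
  exact ENNReal.toReal_mono
    (ENNReal.sum_ne_top.2 fun i _ => ENNReal.mul_ne_top ENNReal.ofReal_ne_top (hZfin i)) h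

/-- The average regret of the Bayesian filter for a nondegenerate mixture is at most the
worst-case regret of any causal filter. -/
theorem sum_mul_regret_le_minimaxRegret (H : IsFilteringModel S K l T X Y P) {j : ι → Θ}
    {w : ι → ℝ} (hw : w ∈ openSimplex ι) :
    ((∑ i, w i * ((cmleBayes T l X Y (P (j i)) (mixture (P ∘ j) w)).toReal
      - (cmleBayes T l X Y (P (j i)) (P (j i))).toReal) : ℝ) : EReal)
      ≤ minimaxRegret T K l X Y P := by
  refine le_iInf₂ fun Z hZ => ?_
  by_cases hfin : ∀ i, cmle T l X (P (j i)) Z ≠ ∞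
  · have h1 := H.sum_mul_cmleBayes_le hZ hfin hw
    have hne : (Finset.univ : Finset ι).Nonempty := by
      by_contra he
      have := hw.2
      rw [Finset.not_nonempty_iff_eq_empty.1 he] at this
      simp at this
    obtain ⟨i, -, hi⟩ := Finset.exists_le_of_sum_le (s := Finset.univ)
      (f := fun i => w i * ∑ k, w k * ((cmleBayes T l X Y (P (j k)) (mixture (P ∘ j) w)).toReal
        - (cmleBayes T l X Y (P (j k)) (P (j k))).toReal))
      (g := fun i => w i * ((cmle T l X (P (j i)) Z).toReal
        - (cmleBayes T l X Y (P (j i)) (P (j i))).toReal)) hne (by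
      rw [← Finset.sum_mul, hw.2, one_mul]
      simp only [mul_sub, Finset.sum_sub_distrib]
      linarith)
    refine le_iSup_of_le (j i) ?_
    rw [regret, EReal.coe_ennreal_sub_coe_ennreal (hfin i) (H.finite _)]
    exact_mod_cast le_of_mul_le_mul_left hi (hw.1 i)
  · push Not at hfin
    obtain ⟨i, hi⟩ := hfin
    refine le_iSup_of_le (j i) ?_
    rw [regret, hi, EReal.top_sub_coe_ennreal (H.finite _)]
    exact le_top

/-- Lower semicontinuity of the mismatched errors in the mixture weights, along segments. -/
theorem eventually_lt_cmleBayes_mixture (H : IsFilteringModel S K l T X Y P) {j : ι → Θ}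
    {w v : ι → ℝ} (hw : w ∈ openSimplex ι) (hv : v ∈ openSimplex ι) (θ : Θ) {c : ℝ≥0∞}
    (hc : c < cmleBayes T l X Y (P θ) (mixture (P ∘ j) w)) :
    ∀ᶠ n : ℕ in atTop, c < cmleBayes T l X Y (P θ) (mixture (P ∘ j)
      fun i => (1 - 1 / (n + 2 : ℝ)) * w i + 1 / (n + 2 : ℝ) * v i) := by
  have hQw := H.isMixtureLaw
    (mixture_mem_convexHull (P := P ∘ j) (fun i => mem_range_self (j i)) hw)
  have hQv := H.isMixtureLaw
    (mixture_mem_convexHull (P := P ∘ j) (fun i => mem_range_self (j i)) hv)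
  have := H.prob θ
  have := hQw.prob
  have := hQv.prob
  let ε : ℕ → ℝ≥0 := fun n => 1 / (n + 2)
  have hε1 : ∀ n, ε n < 1 := fun n => by
    have h : (1 : ℝ≥0) < n + 2 := lt_of_lt_of_le one_lt_two le_add_self
    exact (div_lt_one (zero_lt_one.trans h)).2 h
  have hε : Tendsto ε atTop (𝓝 0) := by
    refine NNReal.tendsto_coe.1 ?_
    have := (tendsto_one_div_add_atTop_nhds_zero_nat (𝕜 := ℝ)).comp (tendsto_add_atTop_nat 1)
    refine this.congr fun n => ?_
    simp [ε]
    ring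
  have h := cmleBayes_le_liminf (P := P θ) (Q₀ := mixture (P ∘ j) w) (Q₁ := mixture (P ∘ j) v)
    H.nonneg H.subset H.isOpen H.convex H.loss H.signal H.signal_mem H.obs hQw.integrable
    hQv.integrable (fun t ht A hA => (hQw.null_iff θ t ht A hA).1)
    (fun t ht A hA h => (hQv.null_iff θ t ht A hA).2 ((hQw.null_iff θ t ht A hA).1 h)) hε1 hε
  filter_upwards [eventually_lt_of_lt_liminf (hc.trans_le h)] with n hn
  rw [← mixture_combo (P ∘ j) hw hv (hε1 n).le] at hn
  simpa [ε] using hn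

/-- For finitely many of the laws, some mixture has all its regrets nearly below a finite minimax
regret. -/
theorem exists_mixture_le [Nonempty ι] (H : IsFilteringModel S K l T X Y P) (j : ι → Θ) {V : ℝ}
    (hV : minimaxRegret T K l X Y P = V) {δ : ℝ} (hδ : 0 < δ) :
    ∃ Q ∈ convexHull ℝ≥0 (range P), ∀ i, cmleBayes T l X Y (P (j i)) Q
      ≤ cmleBayes T l X Y (P (j i)) (P (j i)) + ENNReal.ofReal (V + δ) := by
  obtain ⟨Z, hZ, hZV⟩ : ∃ Z, IsCausalFilter T K Y Z ∧ ⨆ θ, regret T l X Y (P θ) Z < ⊤ := by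
    have h : minimaxRegret T K l X Y P < ⊤ := hV ▸ EReal.coe_lt_top V
    simpa only [minimaxRegret, iInf_lt_iff, exists_prop] using h
  have hZfin : ∀ i, cmle T l X (P (j i)) Z ≠ ∞ := fun i h => by
    have h1 := (le_iSup (fun θ => regret T l X Y (P θ) Z) (j i)).trans_lt hZV
    simp only [regret, h, EReal.top_sub_coe_ennreal (H.finite (j i)), lt_self_iff_false] at h1
  let c : ι → ℝ := fun i => (cmleBayes T l X Y (P (j i)) (P (j i))).toReal
  let b : (ι → ℝ) → ι → ℝ := fun w i =>
    (cmleBayes T l X Y (P (j i)) (mixture (P ∘ j) w)).toReal - c i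
  have hmem : ∀ w ∈ openSimplex ι, mixture (P ∘ j) w ∈ convexHull ℝ≥0 (range P) := fun w hw =>
    mixture_mem_convexHull (fun i => mem_range_self (j i)) hw
  have hfin : ∀ w ∈ openSimplex ι, ∀ i, cmleBayes T l X Y (P (j i)) (mixture (P ∘ j) w) ≠ ∞ :=
    fun w hw => H.cmleBayes_mixture_ne_top hZ hZfin hw
  have h0 : ∀ w ∈ openSimplex ι, ∀ i, 0 ≤ b w i := fun w hw i =>
    sub_nonneg.2 (ENNReal.toReal_mono (hfin w hw i)
      (H.cmleBayes_self_le (j i) (H.isMixtureLaw (hmem w hw))))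
  obtain ⟨w, hw, hwV⟩ := exists_forall_le_of_bayesRisk_le (b := b) h0
    (fun w hw w' hw' => by
      have hQ' := H.isMixtureLaw (hmem w' hw')
      obtain ⟨Z', hZ'⟩ := H.exists_isBayesFilter hQ'
      have h := H.sum_mul_cmleBayes_le (j := j) hZ'.isCausalFilter
        (fun i => by rw [H.cmle_eq hQ' hZ']; exact hfin w' hw' i) hw
      simp only [H.cmle_eq hQ' hZ'] at h
      simp only [b, mul_sub, Finset.sum_sub_distrib]
      linarith)
    (fun w hw v hv i a ha => by
      by_cases ha0 : a < 0
      · refine .of_forall fun n => ha0.trans_le (h0 _ (openSimplex_combo hw hv (by positivity) ?_) i)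
        rw [div_lt_one (by positivity)]
        linarith [(Nat.cast_nonneg n : (0 : ℝ) ≤ n)]
      · have hac : 0 ≤ a + c i := add_nonneg (not_lt.1 ha0) ENNReal.toReal_nonneg
        have h1 : ENNReal.ofReal (a + c i)
            < cmleBayes T l X Y (P (j i)) (mixture (P ∘ j) w) := by
          rw [ENNReal.ofReal_lt_iff_lt_toReal hac (hfin w hw i)]
          exact lt_sub_iff_add_lt.1 ha
        filter_upwards [H.eventually_lt_cmleBayes_mixture hw hv (j i) h1] with n hn
        refine lt_sub_iff_add_lt.2 ?_
        rwa [← ENNReal.ofReal_lt_iff_lt_toReal hac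
          (hfin _ (openSimplex_combo hw hv (by positivity) ?_) i)]
        rw [div_lt_one (by positivity)]
        linarith [(Nat.cast_nonneg n : (0 : ℝ) ≤ n)])
    (V := V) (fun w hw => by
      have h := H.sum_mul_regret_le_minimaxRegret (j := j) hw
      rw [hV] at h
      exact_mod_cast h) hδ
  refine ⟨_, hmem w hw, fun i => ?_⟩
  have hVδ : 0 ≤ V + δ := (h0 w hw i).trans (hwV i)
  rw [← ENNReal.toReal_le_toReal (hfin w hw i)
    (ENNReal.add_ne_top.2 ⟨H.finite _, ENNReal.ofReal_ne_top⟩),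
    ENNReal.toReal_add (H.finite _) ENNReal.ofReal_ne_top, ENNReal.toReal_ofReal hVδ]
  have := hwV i
  simp only [b, c] at this
  linarith

/-- By compactness, some mixture has all its regrets below the minimax regret. -/
theorem exists_regretBayes_le [Nonempty Θ] (H : IsFilteringModel S K l T X Y P)
    [TopologicalSpace (Measure Ω)] (hcomp : IsCompact (convexHull ℝ≥0 (range P)))
    (hlsc : ∀ θ, LowerSemicontinuousOn (fun Q => cmleBayes T l X Y (P θ) Q)
      (convexHull ℝ≥0 (range P))) :
    ∃ Q ∈ convexHull ℝ≥0 (range P),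
      ⨆ θ, regretBayes T l X Y (P θ) Q ≤ minimaxRegret T K l X Y P := by
  classical
  by_cases htop : minimaxRegret T K l X Y P = ⊤
  · exact ⟨_, subset_convexHull ℝ≥0 (range P) (mem_range_self (Classical.arbitrary Θ)),
      htop ▸ le_top⟩
  obtain ⟨V, hV⟩ : ∃ V : ℝ, minimaxRegret T K l X Y P = V := by
    have hbot : minimaxRegret T K l X Y P ≠ ⊥ :=
      (lt_of_lt_of_le EReal.bot_lt_zero H.minimaxRegret_nonneg).ne'
    exact ⟨_, (EReal.coe_toReal htop hbot).symm⟩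
  have hV0 : 0 ≤ V := by
    have := H.minimaxRegret_nonneg
    rw [hV] at this
    exact_mod_cast this
  let r : Θ × ℕ → ℝ≥0∞ := fun p =>
    cmleBayes T l X Y (P p.1) (P p.1) + ENNReal.ofReal (V + 1 / (p.2 + 1 : ℝ))
  choose C hCc hC using fun p : Θ × ℕ =>
    lowerSemicontinuousOn_iff_preimage_Iic.1 (hlsc p.1) (r p)
  obtain ⟨Q, hQ, hQC⟩ := hcomp.inter_iInter_nonempty C hCc fun u => by
    let s : Finset Θ := insert (Classical.arbitrary Θ) (u.image Prod.fst)
    have : Nonempty s := ⟨⟨_, Finset.mem_insert_self _ _⟩⟩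
    let N : ℕ := u.sup Prod.snd
    obtain ⟨Q, hQ, hQle⟩ := H.exists_mixture_le (fun i : s => (i : Θ)) hV
      (δ := 1 / (N + 1 : ℝ)) (by positivity)
    refine ⟨Q, hQ, mem_iInter₂.2 fun p hp => ?_⟩
    have hps : p.1 ∈ s := Finset.mem_insert_of_mem (Finset.mem_image_of_mem _ hp)
    have hpN : (p.2 : ℝ) ≤ N := by exact_mod_cast Finset.le_sup (f := Prod.snd) hp
    have hle : cmleBayes T l X Y (P p.1) Q ≤ r p := by
      refine (hQle ⟨p.1, hps⟩).trans (add_le_add le_rfl (ENNReal.ofReal_le_ofReal ?_))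
      gcongr
    exact ((hC p).subset ⟨hQ, hle⟩).2
  refine ⟨Q, hQ, iSup_le fun θ => ?_⟩
  have hle : ∀ n : ℕ, cmleBayes T l X Y (P θ) Q ≤ r (θ, n) := fun n =>
    ((hC (θ, n)).superset ⟨hQ, mem_iInter.1 hQC (θ, n)⟩).2
  have hfin : cmleBayes T l X Y (P θ) Q ≠ ∞ :=
    ne_top_of_le_ne_top (ENNReal.add_ne_top.2 ⟨H.finite θ, ENNReal.ofReal_ne_top⟩) (hle 0)
  rw [regretBayes, EReal.coe_ennreal_sub_coe_ennreal hfin (H.finite θ), hV]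
  have hreal : (cmleBayes T l X Y (P θ) Q).toReal
      - (cmleBayes T l X Y (P θ) (P θ)).toReal ≤ V := by
    refine ge_of_tendsto' (f := fun n : ℕ => V + 1 / (n + 1 : ℝ)) (x := atTop) ?_ fun n => ?_
    · simpa using (tendsto_one_div_add_atTop_nhds_zero_nat (𝕜 := ℝ)).const_add V
    · have h := ENNReal.toReal_mono
        (ENNReal.add_ne_top.2 ⟨H.finite θ, ENNReal.ofReal_ne_top⟩) (hle n)
      rw [ENNReal.toReal_add (H.finite θ) ENNReal.ofReal_ne_top,
        ENNReal.toReal_ofReal (by positivity)] at h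
      simp only at h
      linarith
  exact_mod_cast hreal

end IsFilteringModel

end Model

/-! ### The minimax theorem -/

theorem theorem1 {E Ω 𝒴 Θ : Type*}
    [NormedAddCommGroup E] [NormedSpace ℝ E] [CompleteSpace E] [SecondCountableTopology E]
    [MeasurableSpace E] [BorelSpace E] [MeasurableSpace Ω] [MeasurableSpace 𝒴] [Nonempty Θ]
    -- signal and reconstruction alphabets, loss
    (S K : Set E) (hS : MeasurableSet S) (hSK : S ⊆ K) (hKo : IsOpen K) (hKc : Convex ℝ K)
    (l : E → E → ℝ≥0) (hl : IsMeanLoss S K l)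
    -- signal and observation processes on `[0, T]`
    (T : ℝ) (hT : 0 ≤ T)
    (X : ℝ → Ω → E) (hX : Measurable (Function.uncurry X)) (hXS : ∀ t ∈ Icc 0 T, ∀ ω, X t ω ∈ S)
    (Y : ℝ → Ω → 𝒴) (hY : ∀ t ∈ Icc 0 T, Measurable (Y t))
    -- the uncertainty set of laws
    (P : Θ → Measure Ω) (hP : ∀ θ, IsProbabilityMeasure (P θ))
    -- `E_Q[X_t | Y^t]` makes sense, and regrets are not of the form `∞ - ∞`
    (hint : ∀ θ, Integrable (Function.uncurry X) ((volume.restrict (Icc 0 T)).prod (P θ)))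
    (hfin : ∀ θ, cmleBayes T l X Y (P θ) (P θ) ≠ ∞)
    -- the value of `cmleBayes` does not depend on the choice of the conditional expectations
    (hac : ∀ θ θ', ∀ t ∈ Icc 0 T, ∀ A, MeasurableSet[obs Y t] A → P θ' A = 0 → P θ A = 0)
    -- the convex hull is compact
    [TopologicalSpace (Measure Ω)] (hcomp : IsCompact (convexHull ℝ≥0 (range P)))
    (hlsc : ∀ θ, LowerSemicontinuousOn (fun Q => cmleBayes T l X Y (P θ) Q)
      (convexHull ℝ≥0 (range P))) :
    IsLeast ((fun Q => ⨆ θ, regretBayes T l X Y (P θ) Q) '' convexHull ℝ≥0 (range P))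
        (minimaxRegret T K l X Y P) ∧
      ∃ Q ∈ convexHull ℝ≥0 (range P), (∃ Z, IsBayesFilter T K X Y Q Z) ∧
        ∀ Z, IsBayesFilter T K X Y Q Z →
          ⨆ θ, regret T l X Y (P θ) Z = minimaxRegret T K l X Y P := by
  have H : IsFilteringModel S K l T X Y P :=
    ⟨hS, hSK, hKo, hKc, hl, hT, hX, hXS, hY, hP, hint, hfin, hac⟩
  obtain ⟨Q, hQ, hle⟩ := H.exists_regretBayes_le hcomp hlsc
  have heq : ⨆ θ, regretBayes T l X Y (P θ) Q = minimaxRegret T K l X Y P :=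
    le_antisymm hle (H.minimaxRegret_le (H.isMixtureLaw hQ))
  refine ⟨⟨⟨Q, hQ, heq⟩, ?_⟩, Q, hQ, H.exists_isBayesFilter (H.isMixtureLaw hQ), fun Z hZ => ?_⟩
  · rintro _ ⟨Q', hQ', rfl⟩
    exact H.minimaxRegret_le (H.isMixtureLaw hQ')
  · simp_rw [H.regret_eq (H.isMixtureLaw hQ) hZ]
    exact heq
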